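/- Fix $y\in\mathbb R$. For real polynomials $f,g$ put $$(f,g)_2^y=\int_{-\infty}^y e^{-x^2}f(x)g(x)\,dx,\qquad \langle f,g\rangle_1^y=\frac12\int_{-\infty}^y dx\,e^{-x^2/2}f(x)\int_{-\infty}^y dz\,e^{-z^2/2}g(z)\,\mathrm{sgn}(z-x).$$ Let $p_0,p_1,\dots$ be the monic polynomials with $\deg p_j=j$ and $(p_j,p_k)_2^y=0$ for $j\ne k$, and let $h_j=(p_j,p_j)_2^y$. Put $$\Phi_{j,k}=\frac12\int_{-\infty}^y e^{-z^2/2}p_j(z)\,dz\int_y^\infty e^{-z^2/2}p_k(z)\,dz,\qquad X_{j,k}=\frac12\left(\int_{-\infty}^y p_j(x)e^{-x^2/2}\,\mathrm{erf}\!\left(\tfrac{x}{\sqrt2}\right)dx\right)\int_{-\infty}^\infty e^{-z^2/2}p_k(z)\,dz .$$ Let $v_{j,k}$ ($j,k\ge0$) be the skew-symmetric array with $v_{j,j+1}=h_j-X_{j,j+1}-\Phi_{j,j+1}$ and $v_{j,k}=X_{k,j}+\Phi_{k,j}$ for $k\ge j+2$. Let $\mathbf V_m=[v_{j,k}]_{j,k=0,\dots,m}$,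 with $\mathbf V_{-1}$ the empty matrix and $\mathrm{Pf}\,\mathbf V_{-1}=1$, and let $\mathbf V_m^{(\eta\mapsto\nu)}$ be $\mathbf V_m$ with all occurrences of the index $\eta$ replaced by $\nu$. Then $\mathbf V_m=[\langle p_j,p_k\rangle_1^y]_{j,k=0,\dots,m}$ for all $m$, and $\mathrm{Pf}\,\mathbf V_{2i-1}\neq0$ for all $i\ge0$. Moreover, let $R_j=\sum_{k=0}^{j}\alpha_{j,k}p_k$ ($j\ge 0$) with real $\alpha_{j,k}$ such that $\alpha_{j,j-1}=0$ for all odd $j$, and let $r_0,r_1,\dots$ be real numbers. Then the $R_j$ are monic of degree $j$ and skew-orthogonal with normalizations $r_j$, that is, $$\langle R_{2j},R_{2k}\rangle_1^y=\langle R_{2j+1},R_{2k+1}\rangle_1^y=0,\qquad \langle R_{2j},R_{2k+1}\rangle_1^y=-\langle R_{2k+1},R_{2j}\rangle_1^y=r_j\,\delta_{j,k}\qquad(j,k\ge0),$$ if and only if $\alpha_{j,j}=1$ for all $j$, $$\alpha_{j,k}=\begin{cases}-\dfrac{\mathrm{Pf}\,\mathbf V_{j-1}^{(k\mapsto j)}}{\mathrm{Pf}\,\mathbf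 V_{j-1}},& j\text{ even},\ 0\le k\le j-1,\\[3mm]-\dfrac{\mathrm{Pf}\,\mathbf V_{j-2}^{(k\mapsto j)}}{\mathrm{Pf}\,\mathbf V_{j-2}},& j\text{ odd},\ 0\le k\le j-2,\end{cases}\qquad (j\ge2),$$ and $$r_j=\frac{\mathrm{Pf}\,\mathbf V_{2j+1}}{\mathrm{Pf}\,\mathbf V_{2j-1}}\qquad\text{for all } j\ge0 .$$ -/

import Mathlib

open Polynomial MeasureTheory

namespace GOE

noncomputable section

/-- The inner product `(f, g)₂^y = ∫_{-∞}^y e^{-x²} f(x) g(x) dx`. -/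
def inner2 (y : ℝ) (f g : ℝ[X]) : ℝ :=
  ∫ x in Set.Iic y, Real.exp (-x ^ 2) * f.eval x * g.eval x

/-- The skew-inner product
`⟨f, g⟩₁^y = 1/2 ∫_{-∞}^y dx e^{-x²/2} f(x) ∫_{-∞}^y dz e^{-z²/2} g(z) sgn(z - x)`. -/
def skew1 (y : ℝ) (f g : ℝ[X]) : ℝ :=
  1 / 2 * ∫ x in Set.Iic y, Real.exp (-x ^ 2 / 2) * f.eval x *
    ∫ z in Set.Iic y, Real.exp (-z ^ 2 / 2) * g.eval z * Real.sign (z - x)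

/-- `p` is the sequence of monic orthogonal polynomials, `deg p_j = j`, for the inner product
`(·, ·)₂^y`. -/
structure IsOrthogonal (y : ℝ) (p : ℕ → ℝ[X]) : Prop where
  monic : ∀ j, (p j).Monic
  natDegree : ∀ j, (p j).natDegree = j
  orthogonal : ∀ j k, j ≠ k → inner2 y (p j) (p k) = 0

/-- `R` is a sequence of monic polynomials, `deg R_j = j`, that are skew-orthogonal for
`⟨·, ·⟩₁^y`, with normalizations `r`. -/
structure IsSkewOrthogonal (y : ℝ) (R : ℕ → ℝ[X]) (r : ℕ → ℝ) : Prop where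
  monic : ∀ j, (R j).Monic
  natDegree : ∀ j, (R j).natDegree = j
  even_even : ∀ j k, skew1 y (R (2 * j)) (R (2 * k)) = 0
  odd_odd : ∀ j k, skew1 y (R (2 * j + 1)) (R (2 * k + 1)) = 0
  even_odd : ∀ j k, skew1 y (R (2 * j)) (R (2 * k + 1)) = if j = k then r j else 0
  odd_even : ∀ j k, skew1 y (R (2 * k + 1)) (R (2 * j)) = - (if j = k then r j else 0)

/-- The error function `erf x = (2/√π) ∫_0^x e^{-t²} dt`. -/
def erf (x : ℝ) : ℝ := 2 / √Real.pi * ∫ t in (0 : ℝ)..x, Real.exp (-t ^ 2)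

/-- The normalization `h_j = (p_j, p_j)₂^y`. -/
def h (y : ℝ) (p : ℕ → ℝ[X]) (j : ℕ) : ℝ := inner2 y (p j) (p j)

/-- `Φ_{j,k} = 1/2 ∫_{-∞}^y e^{-z²/2} p_j(z) dz ∫_y^∞ e^{-z²/2} p_k(z) dz`. -/
def Phi (y : ℝ) (p : ℕ → ℝ[X]) (j k : ℕ) : ℝ :=
  1 / 2 * (∫ z in Set.Iic y, Real.exp (-z ^ 2 / 2) * (p j).eval z) *
    ∫ z in Set.Ioi y, Real.exp (-z ^ 2 / 2) * (p k).eval z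

/-- `X_{j,k} = 1/2 (∫_{-∞}^y p_j(x) e^{-x²/2} erf(x/√2) dx) ∫_{-∞}^∞ e^{-z²/2} p_k(z) dz`. -/
def Xi (y : ℝ) (p : ℕ → ℝ[X]) (j k : ℕ) : ℝ :=
  1 / 2 * (∫ x in Set.Iic y, (p j).eval x * Real.exp (-x ^ 2 / 2) * erf (x / √2)) *
    ∫ z : ℝ, Real.exp (-z ^ 2 / 2) * (p k).eval z

/-- The entries above the diagonal, `j < k`: on the first superdiagonal
`h_j - X_{j,j+1} - Φ_{j,j+1}`, and `X_{k,j} + Φ_{k,j}` further up. -/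
def upper (y : ℝ) (p : ℕ → ℝ[X]) (j k : ℕ) : ℝ :=
  if k = j + 1 then h y p j - Xi y p j k - Phi y p j k else Xi y p k j + Phi y p k j

/-- The skew-symmetric array `v_{j,k}`, `j, k ≥ 0`. -/
def v (y : ℝ) (p : ℕ → ℝ[X]) (j k : ℕ) : ℝ :=
  if j < k then upper y p j k else if k < j then - upper y p k j else 0

/-- The `m × m` matrix `[v_{j,k}]`, `j, k = 0, …, m - 1`. It is the matrix `𝐕_{m-1}`, whose
subscript is the largest index, so that the empty matrix `V y p 0` is `𝐕_{-1}`. -/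
def V (y : ℝ) (p : ℕ → ℝ[X]) (m : ℕ) : Matrix (Fin m) (Fin m) ℝ :=
  Matrix.of fun a b => v y p a b

/-- The `m × m` matrix `V y p m` with every occurrence of the index `k` replaced by `l`. -/
def Vsubst (y : ℝ) (p : ℕ → ℝ[X]) (m k l : ℕ) : Matrix (Fin m) (Fin m) ℝ :=
  Matrix.of fun a b => v y p (if (a : ℕ) = k then l else a) (if (b : ℕ) = k then l else b)

/-- The Pfaffian of a `2n × 2n` (skew-symmetric) matrix,
`1 / (2ⁿ n!) ∑_σ sgn(σ) ∏_{i < n} M_{σ(2i), σ(2i+1)}`; it is `1` for `n = 0`. -/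
def pf {n : ℕ} (M : Matrix (Fin (2 * n)) (Fin (2 * n)) ℝ) : ℝ :=
  1 / (2 ^ n * (n.factorial : ℝ)) * ∑ σ : Equiv.Perm (Fin (2 * n)),
    ((Equiv.Perm.sign σ : ℤ) : ℝ) *
      ∏ i : Fin n, M (σ ⟨2 * i, by omega⟩) (σ ⟨2 * i + 1, by omega⟩)

/-! The monic orthogonal polynomials exist for every `y`. -/

theorem integrable_poly (f : ℝ[X]) : Integrable fun x : ℝ => Real.exp (-x ^ 2) * f.eval x := by
  induction f using Polynomial.induction_on' with
  | add p q hp hq =>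
    refine (hp.add hq).congr (ae_of_all _ fun x => ?_)
    simp [mul_add]
  | monomial n a =>
    have := integrable_rpow_mul_exp_neg_mul_sq (b := 1) one_pos (s := n)
      (by have : (0 : ℝ) ≤ n := n.cast_nonneg
          linarith)
    refine (this.const_mul a).congr (ae_of_all _ fun x => ?_)
    simp only [eval_monomial, Real.rpow_natCast, neg_mul, one_mul]
    ring

theorem integrable_inner2 (y : ℝ) (f g : ℝ[X]) :
    IntegrableOn (fun x : ℝ => Real.exp (-x ^ 2) * f.eval x * g.eval x) (Set.Iic y) := by
  have := (integrable_poly (f * g)).integrableOn (s := Set.Iic y)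
  simpa only [eval_mul, mul_assoc] using this

theorem inner2_comm (y : ℝ) (f g : ℝ[X]) : inner2 y f g = inner2 y g f := by
  unfold inner2
  congr 1
  ext x
  ring

theorem inner2_add (y : ℝ) (f g k : ℝ[X]) :
    inner2 y f (g + k) = inner2 y f g + inner2 y f k := by
  unfold inner2
  rw [← integral_add (integrable_inner2 y f g) (integrable_inner2 y f k)]
  congr 1
  ext x
  simp only [eval_add]
  ring

theorem inner2_smul (y : ℝ) (f g : ℝ[X]) (c : ℝ) :
    inner2 y f (c • g) = c * inner2 y f g := by
  unfold inner2
  rw [← integral_const_mul]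
  congr 1
  ext x
  simp only [eval_smul, smul_eq_mul]
  ring

theorem eq_zero_of_inner2_self (y : ℝ) (f : ℝ[X]) (hf : inner2 y f f = 0) : f = 0 := by
  unfold inner2 at hf
  have h0 : 0 ≤ᵐ[volume.restrict (Set.Iic y)]
      fun x : ℝ => Real.exp (-x ^ 2) * f.eval x * f.eval x := ae_of_all _ fun x => by
    have := mul_nonneg (Real.exp_pos (-x ^ 2)).le (mul_self_nonneg (f.eval x))
    simpa [mul_assoc] using this
  rw [setIntegral_eq_zero_iff_of_nonneg_ae h0 (integrable_inner2 y f f)] at hf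
  by_contra hne
  have hfin : volume ({x : ℝ | f.IsRoot x}) = 0 := (finite_setOfPred_isRoot hne).measure_zero _
  have h1 : ∀ᵐ x ∂(volume.restrict (Set.Iic y)), ¬ f.IsRoot x :=
    ae_restrict_of_ae (by simpa [ae_iff] using hfin)
  have h2 : ∀ᵐ x ∂(volume.restrict (Set.Iic y)), False := by
    filter_upwards [hf, h1] with x hx hx1
    have : f.eval x ≠ 0 := hx1
    simp [this] at hx
  rw [ae_iff] at h2
  simp at h2

/-- The bilinear form `(·, ·)₂^y` on a space of polynomials, as a map to the dual. -/
def inner2Dual (y : ℝ) (W : Submodule ℝ ℝ[X]) : W →ₗ[ℝ] Module.Dual ℝ W :=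
  LinearMap.mk₂ ℝ (fun f g => inner2 y (f : ℝ[X]) (g : ℝ[X]))
    (fun f g k => by
      simp only [Submodule.coe_add]
      rw [inner2_comm, inner2_add, inner2_comm y k, inner2_comm y k])
    (fun c f g => by
      simp only [Submodule.coe_smul]
      rw [inner2_comm, inner2_smul, inner2_comm y g, smul_eq_mul])
    (fun f g k => by simp only [Submodule.coe_add]; rw [inner2_add])
    (fun c f g => by simp only [Submodule.coe_smul]; rw [inner2_smul, smul_eq_mul])

theorem exists_orthogonal_monic (y : ℝ) (n : ℕ) :
    ∃ f : ℝ[X], f.Monic ∧ f.natDegree = n ∧ ∀ g : ℝ[X], g.degree < n → inner2 y g f = 0 := by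
  have : FiniteDimensional ℝ (degreeLT ℝ n) :=
    Module.Finite.equiv (degreeLTEquiv ℝ n).symm
  have hinj : Function.Injective (inner2Dual y (degreeLT ℝ n)) := by
    rw [injective_iff_map_eq_zero]
    intro f hf
    have := LinearMap.congr_fun hf f
    exact Subtype.ext (eq_zero_of_inner2_self y _ this)
  have hsurj := (LinearMap.injective_iff_surjective_of_finrank_eq_finrank
    (Subspace.dual_finrank_eq (K := ℝ) (V := degreeLT ℝ n)).symm).1 hinj
  let φ : Module.Dual ℝ (degreeLT ℝ n) :=
    { toFun := fun g => inner2 y (X ^ n) (g : ℝ[X])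
      map_add' := fun g k => by simp only [Submodule.coe_add]; rw [inner2_add]
      map_smul' := fun c g => by simp only [Submodule.coe_smul]; rw [inner2_smul]; rfl }
  obtain ⟨q, hq⟩ := hsurj φ
  have hqd : (q : ℝ[X]).degree < n := mem_degreeLT.1 q.2
  refine ⟨X ^ n + (-1 : ℝ) • (q : ℝ[X]), ?_, ?_, ?_⟩
  · exact monic_X_pow_add (lt_of_le_of_lt (degree_smul_le _ _) hqd)
  · exact natDegree_eq_of_degree_eq_some (by
      rw [degree_add_eq_left_of_degree_lt, degree_X_pow]
      rw [degree_X_pow]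
      exact lt_of_le_of_lt (degree_smul_le _ _) hqd)
  · intro g hg
    have h1 : inner2 y (q : ℝ[X]) g = inner2 y (X ^ n) g :=
      LinearMap.congr_fun hq ⟨g, mem_degreeLT.2 hg⟩
    rw [inner2_add, inner2_smul, inner2_comm y g q, h1, inner2_comm y g]
    ring

theorem exists_isOrthogonal (y : ℝ) : ∃ p : ℕ → ℝ[X], IsOrthogonal y p := by
  choose p hm hd ho using exists_orthogonal_monic y
  have hdeg : ∀ j k, j < k → (p j).degree < k := fun j k hjk =>
    lt_of_le_of_lt degree_le_natDegree (by rw [hd]; exact_mod_cast hjk)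
  refine ⟨p, hm, hd, fun j k hjk => ?_⟩
  rcases lt_or_gt_of_ne hjk with hlt | hlt
  · exact ho k _ (hdeg j k hlt)
  · rw [inner2_comm]
    exact ho j _ (hdeg k j hlt)

end

end GOE

/-! Let `F` be the primitive of `e^{-x²/2} f` vanishing at `-∞`. Splitting the sign kernel at `x`
gives `⟨g, f⟩ = 1/2 ∫_{-∞}^y e^{-x²/2} g(x) (F(y) - 2F(x)) dx`, and the rest follows from this
formula.

Gram matrix: write `p_k = c + (q' - x q)` with `deg q < k`. The primitive of `e^{-x²/2} p_k` is then
an error function term plus `e^{-x²/2} q`. The former produces `X + Φ`, the latter `(p_j, q)₂`,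
which vanishes for `k ≤ j` and equals `-h_j` for `k = j + 1` (`IsOrthogonal.v_eq_skew1`).

Nondegeneracy in degree `< 2n` (`eq_zero_of_skew1_eq_zero`): by Rolle, `F(y) - 2F` has at most `2n`
zeros for `f ≠ 0` of degree `< 2n`. A polynomial vanishing at its sign changes is a forbidden test
function if there are fewer than `2n` of them; if there are exactly `2n`, comparing signs at `-∞`
and `y` forces `F(y) = 0`, and `y` is one zero too many.

Pfaffians: `Pf(B A Bᵀ) = det B · Pf A` (`pf_congruence`). For the unitriangular change of basis from
`p` to `R` this gives `Pf V = ∏ r_i`, hence the normalizations and, by nondegeneracy, `Pf V ≠ 0`.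
For the identity with one row replaced it gives a Cramer rule (`pf_replaceIndex`), which solves the
linear system for the coefficients. The condition `α_{j,j-1} = 0` for odd `j` removes the freedom of
adding a multiple of `R_{2i}` to `R_{2i+1}`. -/

namespace GOE

/-! ### Pfaffians: congruence, block diagonal matrices, a Cramer rule. -/

/-- The bijection `(i, b) ↦ 2 i + b`. -/
def pairEquiv (n : ℕ) : Fin n × Fin 2 ≃ Fin (2 * n) where
  toFun x := ⟨2 * x.1 + x.2, by omega⟩
  invFun j := (⟨j / 2, by omega⟩, ⟨j % 2, by omega⟩)
  left_inv x := by
    ext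
    · simp only; omega
    · simp only; omega
  right_inv j := by
    ext
    simp only; omega

theorem prod_fin_two_mul {n : ℕ} (g : Fin (2 * n) → ℝ) :
    ∏ j, g j = ∏ i : Fin n, g ⟨2 * i, by omega⟩ * g ⟨2 * i + 1, by omega⟩ := by
  rw [← (pairEquiv n).prod_comp, Fintype.prod_prod_type]
  simp [Fin.prod_univ_two, pairEquiv]

/-- The index map `2 i ↦ (f i).1`, `2 i + 1 ↦ (f i).2`. -/
def pairIndex {n : ℕ} {m : Type*} (f : Fin n → m × m) (j : Fin (2 * n)) : m :=
  if (j : ℕ) % 2 = 0 then (f ⟨j / 2, by omega⟩).1 else (f ⟨j / 2, by omega⟩).2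

theorem pairIndex_even {n : ℕ} {m : Type*} (f : Fin n → m × m) (i : Fin n) :
    pairIndex f ⟨2 * i, by omega⟩ = (f i).1 := by
  simp [pairIndex]

theorem pairIndex_odd {n : ℕ} {m : Type*} (f : Fin n → m × m) (i : Fin n) :
    pairIndex f ⟨2 * i + 1, by omega⟩ = (f i).2 := by
  have h : (2 * (i : ℕ) + 1) / 2 = i := by omega
  simp [pairIndex, h, Nat.add_mod]

/-- Expanding each entry of `B A Bᵀ` and exchanging the sums turns the sum over permutations into
determinants of columns of `B`. No skew-symmetry is needed. -/
theorem sum_perm_congruence {n : ℕ} (A B : Matrix (Fin (2 * n)) (Fin (2 * n)) ℝ) :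
    ∑ σ : Equiv.Perm (Fin (2 * n)), ((Equiv.Perm.sign σ : ℤ) : ℝ) *
      ∏ i : Fin n, (B * A * B.transpose) (σ ⟨2 * i, by omega⟩) (σ ⟨2 * i + 1, by omega⟩) =
    ∑ f : Fin n → Fin (2 * n) × Fin (2 * n),
      (∏ i, A (f i).1 (f i).2) * (B.submatrix id (pairIndex f)).det := by
  have key : ∀ a b, (B * A * B.transpose) a b =
      ∑ x : Fin (2 * n) × Fin (2 * n), A x.1 x.2 * (B a x.1 * B b x.2) := by
    intro a b
    rw [Fintype.sum_prod_type, Finset.sum_comm]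
    simp only [Matrix.mul_apply, Matrix.transpose_apply, Finset.sum_mul]
    refine Finset.sum_congr rfl fun _ _ => Finset.sum_congr rfl fun _ _ => ?_
    ring
  simp only [key, Finset.prod_univ_sum, Fintype.piFinset_univ, Finset.mul_sum]
  rw [Finset.sum_comm]
  refine Finset.sum_congr rfl fun f _ => ?_
  rw [Matrix.det_apply', Finset.mul_sum]
  refine Finset.sum_congr rfl fun σ _ => ?_
  simp only [Matrix.submatrix_apply, id]
  rw [prod_fin_two_mul]
  simp only [pairIndex_even, pairIndex_odd]
  rw [Finset.prod_mul_distrib]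
  ring

theorem pf_congruence {n : ℕ} (A B : Matrix (Fin (2 * n)) (Fin (2 * n)) ℝ) :
    pf (B * A * B.transpose) = B.det * pf A := by
  have h1 := sum_perm_congruence A B
  have h2 := sum_perm_congruence A 1
  -- Selecting columns of `B` is multiplying `B` by selected columns of the identity, so `det B`
  -- factors out of every term; the remaining sum is the expansion `h2` of `Pf A`.
  have h3 : ∀ F : Fin (2 * n) → Fin (2 * n), (B.submatrix id F).det =
      B.det * ((1 : Matrix (Fin (2 * n)) (Fin (2 * n)) ℝ).submatrix id F).det := by
    intro F
    rw [← Matrix.det_mul]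
    congr 1
    ext a b
    simp [Matrix.mul_apply, Matrix.one_apply]
  simp only [one_mul, mul_one, Matrix.transpose_one] at h2
  unfold pf
  rw [h1, h2]
  simp only [h3, Finset.mul_sum]
  refine Finset.sum_congr rfl fun f _ => ?_
  ring

/-- The block diagonal matrix with the blocks `!![0, r i; -r i, 0]`. -/
def skewBlock (r : ℕ → ℝ) (n : ℕ) : Matrix (Fin (2 * n)) (Fin (2 * n)) ℝ :=
  Matrix.of fun a b => if (a : ℕ) / 2 = b / 2 then
    (if (a : ℕ) < b then r (a / 2) else if (b : ℕ) < a then - r (a / 2) else 0) else 0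

/-- The permutation `(i, b) ↦ (τ i, ε i b)` of pairs. -/
def blockPerm {n : ℕ} (x : Equiv.Perm (Fin n) × (Fin n → Equiv.Perm (Fin 2))) :
    Equiv.Perm (Fin n × Fin 2) :=
  (Equiv.prodCongrRight x.2).trans (Equiv.prodCongrLeft fun _ => x.1)

theorem blockPerm_apply {n : ℕ} (x : Equiv.Perm (Fin n) × (Fin n → Equiv.Perm (Fin 2)))
    (i : Fin n) (b : Fin 2) : blockPerm x (i, b) = (x.1 i, x.2 i b) := rfl

theorem blockPerm_injective {n : ℕ} : Function.Injective (blockPerm (n := n)) := by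
  intro x x' hx
  have h : ∀ i b, (x.1 i, x.2 i b) = (x'.1 i, x'.2 i b) := fun i b => by
    rw [← blockPerm_apply, ← blockPerm_apply, hx]
  refine Prod.ext (Equiv.ext fun i => (Prod.ext_iff.1 (h i 0)).1)
    (funext fun i => Equiv.ext fun b => (Prod.ext_iff.1 (h i b)).2)

/-- The permutation of the pairs acts on two copies of `Fin n`, so its sign enters squared. -/
theorem sign_blockPerm {n : ℕ} (x : Equiv.Perm (Fin n) × (Fin n → Equiv.Perm (Fin 2))) :
    Equiv.Perm.sign (blockPerm x) = ∏ i, Equiv.Perm.sign (x.2 i) := by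
  have : blockPerm x = (Equiv.prodCongrLeft fun _ => x.1 : Equiv.Perm _) *
    (Equiv.prodCongrRight x.2 : Equiv.Perm _) := rfl
  rw [this, Equiv.Perm.sign_mul, Equiv.Perm.sign_prodCongrLeft, Equiv.Perm.sign_prodCongrRight]
  simp

theorem mem_range_blockPerm {n : ℕ} (σ : Equiv.Perm (Fin n × Fin 2))
    (hσ : ∀ i, (σ (i, 0)).1 = (σ (i, 1)).1) : σ ∈ Set.range (blockPerm (n := n)) := by
  have h1 : ∀ i b, (σ (i, b)).1 = (σ (i, 0)).1 := by
    intro i b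
    fin_cases b
    · rfl
    · exact (hσ i).symm
  have hs : Function.Surjective fun i => (σ (i, 0)).1 := by
    intro k
    obtain ⟨⟨i, b⟩, hib⟩ := σ.surjective (k, 0)
    exact ⟨i, by simp only [← h1 i b, hib]⟩
  have hi : ∀ i, Function.Injective fun b => (σ (i, b)).2 := by
    intro i b c hbc
    have : σ (i, b) = σ (i, c) := Prod.ext ((h1 i b).trans (h1 i c).symm) hbc
    exact (Prod.ext_iff.1 (σ.injective this)).2
  refine ⟨(Equiv.ofBijective _ (Finite.surjective_iff_bijective.1 hs),
    fun i => Equiv.ofBijective _ (Finite.injective_iff_bijective.1 (hi i))), ?_⟩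
  ext1 ⟨i, b⟩
  rw [blockPerm_apply]
  exact Prod.ext (h1 i b).symm rfl

theorem skewBlock_pair (r : ℕ → ℝ) {n : ℕ} (i j : Fin n) (b c : Fin 2) :
    skewBlock r n (pairEquiv n (i, b)) (pairEquiv n (j, c)) =
      if i = j then (if b < c then r i else if c < b then - r i else 0) else 0 := by
  have h1 : (2 * (i : ℕ) + b) / 2 = i := by omega
  have h2 : (2 * (j : ℕ) + c) / 2 = j := by omega
  simp only [skewBlock, pairEquiv, Equiv.coe_fn_mk, Matrix.of_apply, h1, h2, Fin.ext_iff]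
  split_ifs <;> first | rfl | (exfalso; omega)

theorem skewBlock_perm (r : ℕ → ℝ) {n : ℕ} (i : Fin n) (ε : Equiv.Perm (Fin 2)) :
    skewBlock r n (pairEquiv n (i, ε 0)) (pairEquiv n (i, ε 1)) =
      ((Equiv.Perm.sign ε : ℤ) : ℝ) * r i := by
  rw [skewBlock_pair, if_pos rfl]
  have hε : ∀ ε : Equiv.Perm (Fin 2), ε = 1 ∨ ε = Equiv.swap 0 1 := by decide
  rcases hε ε with rfl | rfl
  · simp
  · simp

/-- Only permutations carrying pairs to pairs contribute. There are `2ⁿ n!` of them, and each gives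
`∏ r i`, because the signs of its flips occur once in `sign σ` and once in the entries. -/
theorem pf_skewBlock (r : ℕ → ℝ) (n : ℕ) : pf (skewBlock r n) = ∏ i : Fin n, r i := by
  have h : ∑ σ : Equiv.Perm (Fin (2 * n)), ((Equiv.Perm.sign σ : ℤ) : ℝ) *
      ∏ i : Fin n, skewBlock r n (σ ⟨2 * i, by omega⟩) (σ ⟨2 * i + 1, by omega⟩) =
      ∑ _x : Equiv.Perm (Fin n) × (Fin n → Equiv.Perm (Fin 2)), ∏ i : Fin n, r i := by
    rw [← (pairEquiv n).permCongr.sum_comp]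
    symm
    refine Fintype.sum_of_injective blockPerm blockPerm_injective _ _ ?_ ?_
    · intro σ hσ
      have : ∃ i, (σ (i, 0)).1 ≠ (σ (i, 1)).1 := by
        by_contra! hcon
        exact hσ (mem_range_blockPerm σ hcon)
      obtain ⟨i, hi⟩ := this
      refine mul_eq_zero_of_right _ (Finset.prod_eq_zero (Finset.mem_univ i) ?_)
      have e0 : (⟨2 * i, by omega⟩ : Fin (2 * n)) = pairEquiv n (i, 0) := rfl
      have e1 : (⟨2 * i + 1, by omega⟩ : Fin (2 * n)) = pairEquiv n (i, 1) := rfl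
      rw [e0, e1, Equiv.permCongr_apply, Equiv.permCongr_apply, Equiv.symm_apply_apply,
        Equiv.symm_apply_apply, ← Prod.mk.eta (p := σ (i, 0)), ← Prod.mk.eta (p := σ (i, 1)),
        skewBlock_pair, if_neg hi]
    · intro x
      have e0 : ∀ i : Fin n, (⟨2 * i, by omega⟩ : Fin (2 * n)) = pairEquiv n (i, 0) :=
        fun _ => rfl
      have e1 : ∀ i : Fin n, (⟨2 * i + 1, by omega⟩ : Fin (2 * n)) = pairEquiv n (i, 1) :=
        fun _ => rfl
      simp only [e0, e1, Equiv.permCongr_apply, Equiv.symm_apply_apply, blockPerm_apply,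
        skewBlock_perm, Equiv.Perm.sign_permCongr, sign_blockPerm, Finset.prod_mul_distrib]
      rw [Equiv.prod_comp x.1 fun i : Fin n => r i]
      push_cast
      rw [← mul_assoc, ← Finset.prod_mul_distrib]
      have : ∀ i, (((Equiv.Perm.sign (x.2 i) : ℤˣ) : ℤ) : ℝ) *
          (((Equiv.Perm.sign (x.2 i) : ℤˣ) : ℤ) : ℝ) = 1 := fun i => by
        rcases Int.units_eq_one_or (Equiv.Perm.sign (x.2 i)) with h | h <;> simp [h]
      simp [this]
  unfold pf
  rw [h, Finset.sum_const, Finset.card_univ, nsmul_eq_mul]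
  simp only [Fintype.card_prod, Fintype.card_perm, Fintype.card_fin, Fintype.card_pi,
    Finset.prod_const, Finset.card_univ, Nat.factorial_two]
  have : (n.factorial : ℝ) ≠ 0 := by exact_mod_cast n.factorial_ne_zero
  push_cast
  field_simp

/-- A skew-symmetric matrix with the `k`-th row and column replaced by `u` and `-u`. -/
def replaceIndex {n : ℕ} (A : Matrix (Fin n) (Fin n) ℝ) (k : Fin n) (u : Fin n → ℝ) :
    Matrix (Fin n) (Fin n) ℝ :=
  Matrix.of fun a b => if a = k then (if b = k then 0 else u b) else
    if b = k then - u a else A a b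

/-- Cramer's rule for Pfaffians: if `u = -αA`, replacing index `k` by `u` is the congruence by the
identity with `k`-th row `-α`, whose determinant is `-α k`. -/
theorem pf_replaceIndex {n : ℕ} (A : Matrix (Fin (2 * n)) (Fin (2 * n)) ℝ)
    (hA : A.transpose = -A) (u α : Fin (2 * n) → ℝ) (h : ∀ l, u l + ∑ k, α k * A k l = 0)
    (k : Fin (2 * n)) : pf (replaceIndex A k u) = - α k * pf A := by
  have hAe : ∀ a b, A b a = - A a b := fun a b => congrFun (congrFun hA a) b
  have hu : ∀ l, ∑ k, - α k * A k l = u l := fun l => by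
    simp only [neg_mul, Finset.sum_neg_distrib]
    linarith [h l]
  have hu' : ∀ l, ∑ k, A l k * - α k = - u l := fun l => by
    rw [← hu l, ← Finset.sum_neg_distrib]
    refine Finset.sum_congr rfl fun k _ => ?_
    rw [hAe k l]
    ring
  -- The `(k, k)` entry of the congruent matrix: a skew-symmetric form evaluated at `(α, α)`.
  have hdiag : ∑ l, u l * α l = 0 := by
    have h1 : ∑ l, u l * α l = ∑ l, ∑ k, - α k * A k l * α l :=
      Finset.sum_congr rfl fun l _ => by rw [← hu l, Finset.sum_mul]
    have h2 : ∑ l, ∑ k, - α k * A k l * α l = - ∑ l, ∑ k, - α k * A k l * α l := by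
      conv_lhs => rw [Finset.sum_comm]
      simp only [← Finset.sum_neg_distrib]
      refine Finset.sum_congr rfl fun l _ => Finset.sum_congr rfl fun k _ => ?_
      rw [hAe k l]
      ring
    linarith
  have hB : replaceIndex A k u = (Matrix.updateRow 1 k (-α)) * A *
      (Matrix.updateRow 1 k (-α)).transpose := by
    have hrow : ∀ a b, ((Matrix.updateRow 1 k (-α)) * A) a b = if a = k then u b else A a b := by
      intro a b
      rw [Matrix.mul_apply]
      by_cases hak : a = k
      · subst hak
        simpa using hu b
      · simp [Matrix.one_apply, hak]
    ext a b
    rw [Matrix.mul_apply]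
    simp only [hrow, Matrix.transpose_apply, replaceIndex, Matrix.of_apply]
    by_cases hbk : b = k
    · subst hbk
      by_cases hab : a = b
      · subst hab
        simp [hdiag]
      · have := hu' a
        simpa [hab] using this.symm
    · by_cases hak : a = k <;> simp [Matrix.one_apply, hbk, hak]
  rw [hB, pf_congruence, ← Matrix.cramer_transpose_apply]
  simp

/-! ### The skew-inner product in terms of Gaussian primitives. -/

open Filter Topology

theorem integrable_exp_mul_eval (f : ℝ[X]) :
    Integrable fun x : ℝ => Real.exp (-x ^ 2 / 2) * f.eval x := by
  induction f using Polynomial.induction_on' with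
  | add p q hp hq =>
    refine (hp.add hq).congr (ae_of_all _ fun x => ?_)
    simp [mul_add]
  | monomial n a =>
    have := integrable_rpow_mul_exp_neg_mul_sq (b := 1 / 2) (by norm_num) (s := n)
      (by have : (0 : ℝ) ≤ n := n.cast_nonneg
          linarith)
    refine (this.const_mul a).congr (ae_of_all _ fun x => ?_)
    simp only [eval_monomial, Real.rpow_natCast]
    rw [show -(1 / 2) * x ^ 2 = -x ^ 2 / 2 by ring]
    ring

/-- The primitive `x ↦ ∫_{-∞}^x e^{-t²/2} f(t) dt`. -/
noncomputable def primitive (f : ℝ[X]) (x : ℝ) : ℝ :=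
  ∫ t in Set.Iic x, Real.exp (-t ^ 2 / 2) * f.eval t

theorem primitive_sub (f : ℝ[X]) (a b : ℝ) :
    primitive f b - primitive f a = ∫ t in a..b, Real.exp (-t ^ 2 / 2) * f.eval t :=
  intervalIntegral.integral_Iic_sub_Iic (integrable_exp_mul_eval f).integrableOn
    (integrable_exp_mul_eval f).integrableOn

theorem hasDerivAt_primitive (f : ℝ[X]) (x : ℝ) :
    HasDerivAt (primitive f) (Real.exp (-x ^ 2 / 2) * f.eval x) x := by
  have hc : Continuous fun t : ℝ => Real.exp (-t ^ 2 / 2) * f.eval t := by fun_prop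
  have h1 : primitive f = fun x => primitive f 0 +
      ∫ t in (0 : ℝ)..x, Real.exp (-t ^ 2 / 2) * f.eval t := by
    ext x
    rw [← primitive_sub]
    ring
  rw [h1]
  exact (intervalIntegral.integral_hasDerivAt_right (hc.intervalIntegrable _ _)
    (hc.stronglyMeasurableAtFilter _ _) hc.continuousAt).const_add _

theorem continuous_primitive (f : ℝ[X]) : Continuous (primitive f) :=
  continuous_iff_continuousAt.2 fun x => (hasDerivAt_primitive f x).continuousAt

theorem tendsto_primitive_atBot (f : ℝ[X]) : Tendsto (primitive f) atBot (𝓝 0) := by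
  have h := intervalIntegral_tendsto_integral_Iic (0 : ℝ)
    (integrable_exp_mul_eval f).integrableOn tendsto_id
  have h1 : primitive f = fun x => primitive f 0 -
      ∫ t in x..(0 : ℝ), Real.exp (-t ^ 2 / 2) * f.eval t := by
    ext x
    rw [← primitive_sub]
    ring
  rw [h1]
  simpa [primitive] using h.const_sub (primitive f 0)

theorem integrable_mul_primitive (f g : ℝ[X]) :
    Integrable fun x : ℝ => Real.exp (-x ^ 2 / 2) * f.eval x * primitive g x := by
  refine (integrable_exp_mul_eval f).mul_bdd
    (c := ∫ t : ℝ, ‖Real.exp (-t ^ 2 / 2) * g.eval t‖)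
    (continuous_primitive g).aestronglyMeasurable (ae_of_all _ fun x => ?_)
  refine (norm_integral_le_integral_norm _).trans ?_
  exact setIntegral_le_integral (integrable_exp_mul_eval g).norm
    (ae_of_all _ fun _ => norm_nonneg _)

theorem integral_mul_sign (g : ℝ[X]) {x y : ℝ} (hxy : x ≤ y) :
    ∫ z in Set.Iic y, Real.exp (-z ^ 2 / 2) * g.eval z * Real.sign (z - x) =
      primitive g y - 2 * primitive g x := by
  have hi := integrable_exp_mul_eval g
  have h1 : Set.EqOn (fun z => -(Real.exp (-z ^ 2 / 2) * g.eval z))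
      (fun z => Real.exp (-z ^ 2 / 2) * g.eval z * Real.sign (z - x)) (Set.Iio x) := fun z hz => by
    simp only
    rw [Real.sign_of_neg (sub_neg.2 hz)]
    ring
  have h2 : Set.EqOn (fun z => Real.exp (-z ^ 2 / 2) * g.eval z)
      (fun z => Real.exp (-z ^ 2 / 2) * g.eval z * Real.sign (z - x)) (Set.Ioc x y) :=
    fun z hz => by
      simp only
      rw [Real.sign_of_pos (sub_pos.2 hz.1)]
      ring
  have hI1 := (hi.neg.integrableOn (s := Set.Iio x)).congr_fun h1 measurableSet_Iio
  have hI2 := (hi.integrableOn (s := Set.Ioc x y)).congr_fun h2 measurableSet_Ioc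
  rw [← Set.Iic_union_Ioc_eq_Iic hxy, setIntegral_union (Set.Iic_disjoint_Ioc le_rfl)
    measurableSet_Ioc ((integrableOn_Iic_iff_integrableOn_Iio).2 hI1) hI2,
    integral_Iic_eq_integral_Iio, ← setIntegral_congr_fun measurableSet_Iio h1,
    ← setIntegral_congr_fun measurableSet_Ioc h2, integral_neg,
    ← intervalIntegral.integral_of_le hxy, ← primitive_sub, ← integral_Iic_eq_integral_Iio]
  change - primitive g x + _ = _
  ring

theorem skew1_eq (y : ℝ) (f g : ℝ[X]) :
    skew1 y f g = 1 / 2 * ∫ x in Set.Iic y, Real.exp (-x ^ 2 / 2) * f.eval x *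
      (primitive g y - 2 * primitive g x) := by
  unfold skew1
  congr 1
  refine setIntegral_congr_fun measurableSet_Iic fun x hx => ?_
  rw [← integral_mul_sign g hx]

theorem integrable_skew1 (y : ℝ) (f g : ℝ[X]) :
    Integrable fun x : ℝ => Real.exp (-x ^ 2 / 2) * f.eval x *
      (primitive g y - 2 * primitive g x) := by
  refine (((integrable_exp_mul_eval f).mul_const (primitive g y)).sub
    ((integrable_mul_primitive f g).const_mul 2)).congr (ae_of_all _ fun x => ?_)
  simp only [Pi.sub_apply]
  ring

theorem skew1_eq_primitive (y : ℝ) (f g : ℝ[X]) :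
    skew1 y f g = 1 / 2 * primitive f y * primitive g y -
      ∫ x in Set.Iic y, Real.exp (-x ^ 2 / 2) * f.eval x * primitive g x := by
  rw [skew1_eq]
  have h : ∀ x : ℝ, Real.exp (-x ^ 2 / 2) * f.eval x * (primitive g y - 2 * primitive g x) =
      Real.exp (-x ^ 2 / 2) * f.eval x * primitive g y -
        2 * (Real.exp (-x ^ 2 / 2) * f.eval x * primitive g x) := fun x => by ring
  simp only [h]
  rw [integral_sub ((integrable_exp_mul_eval f).mul_const _).integrableOn
    ((integrable_mul_primitive f g).const_mul 2).integrableOn, integral_mul_const,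
    integral_const_mul]
  change 1 / 2 * (primitive f y * _ - _) = _
  ring

/-- Integration by parts: the derivative of the product of the two primitives integrates to its
value at `y`. -/
theorem skew1_swap (y : ℝ) (f g : ℝ[X]) : skew1 y g f = - skew1 y f g := by
  have hd : ∀ x, HasDerivAt (fun x => primitive f x * primitive g x)
      (Real.exp (-x ^ 2 / 2) * f.eval x * primitive g x +
        Real.exp (-x ^ 2 / 2) * g.eval x * primitive f x) x := fun x =>
    ((hasDerivAt_primitive f x).mul (hasDerivAt_primitive g x)).congr_deriv (by ring)
  have ht := (tendsto_primitive_atBot f).mul (tendsto_primitive_atBot g)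
  have h := integral_Iic_of_hasDerivAt_of_tendsto' (a := y) (fun x _ => hd x)
    ((integrable_mul_primitive f g).add (integrable_mul_primitive g f)).integrableOn ht
  rw [integral_add (integrable_mul_primitive f g).integrableOn
    (integrable_mul_primitive g f).integrableOn] at h
  rw [skew1_eq_primitive, skew1_eq_primitive]
  linarith

theorem skew1_self (y : ℝ) (f : ℝ[X]) : skew1 y f f = 0 := by
  linarith [skew1_swap y f f]

theorem skew1_add_left (y : ℝ) (f g k : ℝ[X]) :
    skew1 y (f + g) k = skew1 y f k + skew1 y g k := by
  rw [skew1_eq, skew1_eq, skew1_eq, ← mul_add,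
    ← integral_add (integrable_skew1 y f k).integrableOn (integrable_skew1 y g k).integrableOn]
  congr 2
  ext x
  rw [eval_add]
  ring

theorem skew1_smul_left (y : ℝ) (c : ℝ) (f g : ℝ[X]) :
    skew1 y (c • f) g = c * skew1 y f g := by
  have h : ∀ x : ℝ, Real.exp (-x ^ 2 / 2) * (c • f).eval x *
      (primitive g y - 2 * primitive g x) = c * (Real.exp (-x ^ 2 / 2) * f.eval x *
        (primitive g y - 2 * primitive g x)) := fun x => by
    rw [eval_smul, smul_eq_mul]
    ring
  rw [skew1_eq, skew1_eq]
  simp only [h]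
  rw [integral_const_mul]
  ring

/-- The skew-inner product as a bilinear form. -/
noncomputable def skewForm (y : ℝ) : ℝ[X] →ₗ[ℝ] ℝ[X] →ₗ[ℝ] ℝ :=
  LinearMap.mk₂ ℝ (skew1 y) (skew1_add_left y) (skew1_smul_left y)
    (fun f g k => by
      rw [skew1_swap, skew1_add_left, skew1_swap y f g, skew1_swap y f k]
      ring)
    (fun c f g => by
      rw [skew1_swap, skew1_smul_left, skew1_swap y f g, smul_eq_mul]
      ring)

theorem skewForm_apply (y : ℝ) (f g : ℝ[X]) : skewForm y f g = skew1 y f g := rfl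

/-! ### The explicit entries of the Gram matrix. -/

theorem primitive_add (f g : ℝ[X]) (x : ℝ) :
    primitive (f + g) x = primitive f x + primitive g x := by
  unfold primitive
  rw [← integral_add (integrable_exp_mul_eval f).integrableOn
    (integrable_exp_mul_eval g).integrableOn]
  simp only [eval_add, mul_add]

theorem hasDerivAt_exp_mul_eval (q : ℝ[X]) (x : ℝ) :
    HasDerivAt (fun x => Real.exp (-x ^ 2 / 2) * q.eval x)
      (Real.exp (-x ^ 2 / 2) * (derivative q - X * q).eval x) x := by
  have h1 : HasDerivAt (fun x : ℝ => Real.exp (-x ^ 2 / 2))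
      (Real.exp (-x ^ 2 / 2) * (-x)) x := by
    refine ((((hasDerivAt_id x).pow 2).neg.div_const 2).exp).congr_deriv ?_
    simp
    ring
  refine (h1.mul (q.hasDerivAt x)).congr_deriv ?_
  simp only [eval_sub, eval_mul, eval_X]
  ring

theorem primitive_derivative_sub (q : ℝ[X]) (x : ℝ) :
    primitive (derivative q - X * q) x = Real.exp (-x ^ 2 / 2) * q.eval x := by
  have ht := tendsto_zero_of_hasDerivAt_of_integrableOn_Iic (a := x)
    (fun t _ => hasDerivAt_exp_mul_eval q t) (integrable_exp_mul_eval _).integrableOn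
    (integrable_exp_mul_eval _).integrableOn
  have := integral_Iic_of_hasDerivAt_of_tendsto' (a := x)
    (fun t _ => hasDerivAt_exp_mul_eval q t) (integrable_exp_mul_eval _).integrableOn ht
  simpa [primitive] using this

theorem integral_derivative_sub (q : ℝ[X]) :
    ∫ x : ℝ, Real.exp (-x ^ 2 / 2) * (derivative q - X * q).eval x = 0 :=
  integral_eq_zero_of_hasDerivAt_of_integrable (hasDerivAt_exp_mul_eval q)
    (integrable_exp_mul_eval _) (integrable_exp_mul_eval _)

theorem integral_exp_neg_sq_div_two : ∫ x : ℝ, Real.exp (-x ^ 2 / 2) = √2 * √Real.pi := by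
  rw [← Real.sqrt_mul zero_le_two, show 2 * Real.pi = Real.pi / (1 / 2) by ring,
    ← integral_gaussian]
  congr 1
  ext x
  ring_nf

theorem primitive_one (x : ℝ) :
    primitive 1 x = √2 * √Real.pi / 2 * (1 + erf (x / √2)) := by
  have h0 : primitive 1 0 = √2 * √Real.pi / 2 := by
    have h := integral_gaussian_Ioi (1 / 2)
    rw [← neg_zero, ← integral_comp_neg_Iic] at h
    rw [primitive, ← Real.sqrt_mul zero_le_two]
    convert h using 2
    · ext x
      simp
      ring
    · congr 1
      ring
  have h1 : primitive 1 x - primitive 1 0 =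
      √2 * ∫ t in (0 : ℝ)..(x / √2), Real.exp (-t ^ 2) := by
    rw [primitive_sub]
    have h := intervalIntegral.integral_comp_div (a := 0) (b := x)
      (fun t => Real.exp (-t ^ 2)) (c := √2) (by positivity)
    rw [zero_div, smul_eq_mul] at h
    rw [← h]
    refine intervalIntegral.integral_congr fun t _ => ?_
    simp [div_pow, neg_div]
  have hpi : √Real.pi ≠ 0 := by positivity
  rw [← sub_add_cancel (primitive 1 x) (primitive 1 0), h1, h0, erf]
  field_simp
  ring

/-- For `q = -a x^d`, `q' - x q = a x^{d+1} - a d x^{d-1}`, which cancels the top term of `g`. -/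
theorem degree_sub_derivative_sub_le {d : ℕ} {g : ℝ[X]} (hg : g.degree ≤ (d + 1 : WithBot ℕ)) {a : ℝ}
    (ha : g.coeff (d + 1) = a) :
    (g - (derivative (-(C a * X ^ d)) - X * (-(C a * X ^ d)))).degree ≤ (d : WithBot ℕ) := by
  rw [degree_le_iff_coeff_zero]
  intro m hm
  obtain ⟨n, rfl⟩ : ∃ n, m = n + 1 := ⟨m - 1, by have : d < m := by exact_mod_cast hm
                                                 omega⟩
  have hn : d ≤ n := by
    have : d < n + 1 := by exact_mod_cast hm
    omega
  rcases hn.eq_or_lt with rfl | hlt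
  · have h3 : d + 1 + 1 ≠ d := by omega
    simp [coeff_derivative, coeff_X_pow, ha, h3]
  · have h1 : g.coeff (n + 1) = 0 := coeff_eq_zero_of_degree_lt (hg.trans_lt (by
      exact_mod_cast (by omega : d + 1 < n + 1)))
    have h2 : n ≠ d := by omega
    have h3 : n + 1 + 1 ≠ d := by omega
    simp [coeff_derivative, coeff_X_pow, h1, h2, h3]

/-- Modulo the weighted exact polynomials `q' - x q`, every polynomial is a constant. -/
theorem exists_eq_C_add_derivative_sub (d : ℕ) (g : ℝ[X]) (hg : g.degree ≤ d) :
    ∃ (c : ℝ) (q : ℝ[X]), g = C c + (derivative q - X * q) ∧ q.degree < d := by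
  induction d generalizing g with
  | zero =>
    exact ⟨g.coeff 0, 0, by simpa using eq_C_of_degree_le_zero hg, by simp⟩
  | succ d ih =>
    obtain ⟨c, q, hq, hqd⟩ := ih _ (degree_sub_derivative_sub_le (by exact_mod_cast hg) rfl)
    refine ⟨c, q + -(C (g.coeff (d + 1)) * X ^ d), ?_, ?_⟩
    · rw [sub_eq_iff_eq_add] at hq
      refine hq.trans ?_
      rw [derivative_add]
      ring
    · have hlt : (d : WithBot ℕ) < (d + 1 : ℕ) := by exact_mod_cast d.lt_succ_self
      refine (degree_add_le _ _).trans_lt (max_lt (hqd.trans hlt) ?_)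
      rw [degree_neg]
      exact (degree_C_mul_X_pow_le _ _).trans_lt hlt

/-- For monic `g` the leading term of `q` is `-x^d`; this sign produces the `+h_j` on the
superdiagonal. -/
theorem exists_eq_C_add_derivative_sub_of_monic {d : ℕ} {g : ℝ[X]} (hg : g.Monic)
    (hd : g.natDegree = d + 1) :
    ∃ (c : ℝ) (q : ℝ[X]), g = C c + (derivative q - X * q) ∧ (q + X ^ d).degree < (d : WithBot ℕ) := by
  have hdeg : g.degree ≤ d + 1 := by
    have := degree_le_natDegree (p := g)
    rw [hd] at this
    exact_mod_cast this
  have hco : g.coeff (d + 1) = 1 := by rw [← hd]; exact hg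
  obtain ⟨c, q, hq, hqd⟩ := exists_eq_C_add_derivative_sub d _
    (degree_sub_derivative_sub_le hdeg hco)
  refine ⟨c, q + -(C 1 * X ^ d), ?_, ?_⟩
  · rw [sub_eq_iff_eq_add] at hq
    rw [hq, derivative_add]
    ring
  · simpa using hqd

theorem mem_of_degree_lt {p : ℕ → ℝ[X]} (hm : ∀ j, (p j).Monic) (hd : ∀ j, (p j).natDegree = j)
    {W : Submodule ℝ ℝ[X]} {n : ℕ} (hW : ∀ j < n, p j ∈ W) {g : ℝ[X]} (hg : g.degree < n) :
    g ∈ W := by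
  induction n generalizing g with
  | zero =>
    have : g = 0 := by simpa [Nat.WithBot.lt_zero_iff] using hg
    simp [this]
  | succ n ih =>
    have hlt : (g - g.coeff n • p n).degree < n := by
      rw [degree_lt_iff_coeff_zero]
      intro m hnm
      rcases hnm.eq_or_lt with rfl | hlt
      · have : (p n).coeff n = 1 := by simpa [Monic, leadingCoeff, hd] using hm n
        simp [this]
      · have h1 : (p n).coeff m = 0 := coeff_eq_zero_of_natDegree_lt (by rwa [hd])
        have h2 : g.coeff m = 0 := coeff_eq_zero_of_degree_lt (hg.trans_le (by exact_mod_cast hlt))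
        simp [h1, h2]
    have := W.add_mem (ih (fun j hj => hW j (by omega)) hlt)
      (W.smul_mem (g.coeff n) (hW n n.lt_succ_self))
    simpa using this

theorem IsOrthogonal.inner2_eq_zero {y : ℝ} {p : ℕ → ℝ[X]} (hp : IsOrthogonal y p) {n : ℕ}
    {g : ℝ[X]} (hg : g.degree < n) : inner2 y (p n) g = 0 := by
  let φ : ℝ[X] →ₗ[ℝ] ℝ :=
    { toFun := inner2 y (p n)
      map_add' := inner2_add y (p n)
      map_smul' := fun c g => inner2_smul y (p n) g c }
  exact mem_of_degree_lt hp.monic hp.natDegree (W := φ.ker)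
    (fun j hj => hp.orthogonal n j hj.ne') hg

theorem skew1_C_add_derivative_sub (y : ℝ) (p : ℕ → ℝ[X]) (j k : ℕ) {c : ℝ} {q : ℝ[X]}
    (hq : p k = C c + (derivative q - X * q)) :
    skew1 y (p j) (p k) = - (Xi y p j k + Phi y p j k + inner2 y (p j) q) := by
  -- The exact part has total integral zero, so `c` is determined by the full Gaussian integral of
  -- `p k` occurring in `Xi`.
  have htot : ∫ z : ℝ, Real.exp (-z ^ 2 / 2) * (p k).eval z = c * (√2 * √Real.pi) := by
    have h : ∀ z : ℝ, Real.exp (-z ^ 2 / 2) * (p k).eval z = Real.exp (-z ^ 2 / 2) * c +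
        Real.exp (-z ^ 2 / 2) * (derivative q - X * q).eval z := fun z => by
      rw [hq, eval_add, eval_C, mul_add]
    simp only [h]
    have hi : Integrable fun z : ℝ => Real.exp (-z ^ 2 / 2) * c := by
      simpa using integrable_exp_mul_eval (C c)
    rw [integral_add hi (integrable_exp_mul_eval _), integral_derivative_sub, add_zero,
      integral_mul_const, integral_exp_neg_sq_div_two, mul_comm]
  have hprim : ∀ x, primitive (p k) x =
      c * (√2 * √Real.pi) / 2 * (1 + erf (x / √2)) + Real.exp (-x ^ 2 / 2) * q.eval x := by
    intro x
    have hC : primitive (C c) x = c * primitive 1 x := by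
      simp only [primitive, eval_C, eval_one, mul_one]
      rw [integral_mul_const, mul_comm]
    rw [hq, primitive_add, primitive_derivative_sub, hC, primitive_one]
    ring
  have hw : ∀ x : ℝ, Real.exp (-x ^ 2) = Real.exp (-x ^ 2 / 2) * Real.exp (-x ^ 2 / 2) :=
    fun x => by rw [← Real.exp_add]; congr 1; ring
  have hint : ∀ x : ℝ, Real.exp (-x ^ 2 / 2) * (p j).eval x * primitive (p k) x =
      c * (√2 * √Real.pi) / 2 * (Real.exp (-x ^ 2 / 2) * (p j).eval x) +
      c * (√2 * √Real.pi) / 2 * ((p j).eval x * Real.exp (-x ^ 2 / 2) * erf (x / √2)) +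
      Real.exp (-x ^ 2) * (p j).eval x * q.eval x := fun x => by
    rw [hprim, hw]
    ring
  have hierf : Integrable fun x : ℝ =>
      (p j).eval x * Real.exp (-x ^ 2 / 2) * erf (x / √2) := by
    -- `erf (x / √2)` is expressed through `primitive 1`, whose products are known to be integrable.
    have h := ((integrable_mul_primitive (p j) 1).const_mul (2 / (√2 * √Real.pi))).sub
      (integrable_exp_mul_eval (p j))
    refine h.congr (ae_of_all _ fun x => ?_)
    simp only [Pi.sub_apply, primitive_one]
    field_simp
    ring
  have hsplit : ∫ z in Set.Ioi y, Real.exp (-z ^ 2 / 2) * (p k).eval z =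
      c * (√2 * √Real.pi) - primitive (p k) y := by
    rw [← htot, ← intervalIntegral.integral_Iic_add_Ioi (b := y)
      (integrable_exp_mul_eval (p k)).integrableOn (integrable_exp_mul_eval (p k)).integrableOn]
    simp [primitive]
  rw [skew1_eq_primitive]
  simp only [hint]
  have hi1 := ((integrable_exp_mul_eval (p j)).const_mul
    (c * (√2 * √Real.pi) / 2)).integrableOn (s := Set.Iic y)
  have hi2 := (hierf.const_mul (c * (√2 * √Real.pi) / 2)).integrableOn (s := Set.Iic y)
  have hi12 := hi1.fun_add hi2
  rw [integral_add hi12 (integrable_inner2 y _ _), integral_add hi1 hi2, integral_const_mul, integral_const_mul, Xi, Phi, htot,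
      hsplit]
  change 1 / 2 * primitive (p j) y * primitive (p k) y -
    (c * (√2 * √Real.pi) / 2 * primitive (p j) y + _ + inner2 y (p j) q) =
    -(_ + 1 / 2 * primitive (p j) y * _ + _)
  ring

theorem IsOrthogonal.skew1_of_le {y : ℝ} {p : ℕ → ℝ[X]} (hp : IsOrthogonal y p) {j k : ℕ}
    (hkj : k ≤ j) : skew1 y (p j) (p k) = - (Xi y p j k + Phi y p j k) := by
  obtain ⟨c, q, hq, hqd⟩ := exists_eq_C_add_derivative_sub k (p k)
    (by simpa [hp.natDegree] using degree_le_natDegree (p := p k))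
  rw [skew1_C_add_derivative_sub y p j k hq,
    hp.inner2_eq_zero (hqd.trans_le (by exact_mod_cast hkj)), add_zero]

theorem IsOrthogonal.skew1_succ {y : ℝ} {p : ℕ → ℝ[X]} (hp : IsOrthogonal y p) (j : ℕ) :
    skew1 y (p j) (p (j + 1)) = h y p j - Xi y p j (j + 1) - Phi y p j (j + 1) := by
  obtain ⟨c, q, hq, hqd⟩ := exists_eq_C_add_derivative_sub_of_monic (hp.monic (j + 1))
    (hp.natDegree (j + 1))
  have hX : (p j - X ^ j).degree < (j : WithBot ℕ) := by
    have := degree_sub_lt_left (p := p j) (q := X ^ j)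
      (by rw [degree_X_pow, degree_eq_natDegree (hp.monic j).ne_zero, hp.natDegree])
      (hp.monic j).ne_zero (by rw [(hp.monic j).leadingCoeff, (monic_X_pow j).leadingCoeff])
    rwa [degree_eq_natDegree (hp.monic j).ne_zero, hp.natDegree] at this
  -- The leading terms of `q` and `p j` cancel, whence `(p_j, q)₂ = -h_j`.
  have hsum : inner2 y (p j) (q + p j) = 0 := hp.inner2_eq_zero (by
    have : q + p j = (q + X ^ j) + (p j - X ^ j) := by ring
    rw [this]
    exact (degree_add_le _ _).trans_lt (max_lt hqd hX))
  rw [inner2_add] at hsum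
  rw [skew1_C_add_derivative_sub y p j (j + 1) hq, h]
  linarith

theorem IsOrthogonal.v_eq_skew1 {y : ℝ} {p : ℕ → ℝ[X]} (hp : IsOrthogonal y p) (j k : ℕ) :
    v y p j k = skew1 y (p j) (p k) := by
  have hu : ∀ a b, a < b → upper y p a b = skew1 y (p a) (p b) := by
    intro a b hab
    unfold upper
    split_ifs with hb
    · rw [hb, hp.skew1_succ]
    · rw [skew1_swap, hp.skew1_of_le hab.le, neg_neg]
  unfold v
  split_ifs with h1 h2
  · exact hu j k h1
  · rw [hu k j h2, skew1_swap, neg_neg]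
  · rw [show j = k by omega, skew1_self]

/-! ### Nondegeneracy of the skew-inner product in degrees below `2n`. -/

/-- The monic polynomial with the simple roots `T`. -/
noncomputable def rootsProd (T : Finset ℝ) : ℝ[X] := ∏ t ∈ T, (X - C t)

theorem rootsProd_eval (T : Finset ℝ) (x : ℝ) : (rootsProd T).eval x = ∏ t ∈ T, (x - t) := by
  simp [rootsProd, eval_prod]

theorem rootsProd_natDegree (T : Finset ℝ) : (rootsProd T).natDegree = T.card := by
  rw [rootsProd, natDegree_prod_of_monic _ _ fun t _ => monic_X_sub_C t]
  simp

theorem rootsProd_monic (T : Finset ℝ) : (rootsProd T).Monic :=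
  monic_prod_of_monic _ _ fun t _ => monic_X_sub_C t

theorem rootsProd_pos_of_lt {T : Finset ℝ} {x : ℝ} (h : ∀ t ∈ T, t < x) :
    0 < (rootsProd T).eval x := by
  rw [rootsProd_eval]
  exact Finset.prod_pos fun t ht => sub_pos.2 (h t ht)

theorem rootsProd_pos_of_gt {T : Finset ℝ} {x : ℝ} (hT : Even T.card) (h : ∀ t ∈ T, x < t) :
    0 < (rootsProd T).eval x := by
  rw [rootsProd_eval, ← Finset.prod_congr rfl fun t _ => neg_sub t x, Finset.prod_neg,
    hT.neg_one_pow, one_mul]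
  exact Finset.prod_pos fun t ht => sub_pos.2 (h t ht)

theorem sign_of_ne_zero {ψ : ℝ → ℝ} (hψ : Continuous ψ) {s : Set ℝ} (hs : s.OrdConnected)
    (h0 : ∀ x ∈ s, ψ x ≠ 0) : (∀ x ∈ s, 0 ≤ ψ x) ∨ ∀ x ∈ s, ψ x ≤ 0 := by
  by_contra! hcon
  obtain ⟨⟨a, ha, ha'⟩, b, hb, hb'⟩ := hcon
  obtain ⟨c, hc, hc'⟩ := hs.isPreconnected.intermediate_value ha hb hψ.continuousOn
    (Set.mem_Icc.2 ⟨ha'.le, hb'.le⟩)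
  exact h0 c hc hc'

/-- A continuous function with finitely many zeros is turned into one of constant sign by
multiplication with a product of linear factors at some of its zeros. -/
theorem exists_rootsProd_sign {ψ : ℝ → ℝ} (hψ : Continuous ψ) (Z : Finset ℝ) (y : ℝ)
    (hZy : ∀ z ∈ Z, z < y) (hZ : ∀ x < y, ψ x = 0 → x ∈ Z) :
    ∃ T ⊆ Z, (∀ x < y, 0 ≤ (rootsProd T).eval x * ψ x) ∨
      ∀ x < y, (rootsProd T).eval x * ψ x ≤ 0 := by
  induction Z using Finset.induction_on_max generalizing y with
  | empty =>
    refine ⟨∅, subset_rfl, ?_⟩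
    have := sign_of_ne_zero hψ (s := Set.Iio y) Set.ordConnected_Iio
      fun x hx h => by simpa using hZ x hx h
    simpa [rootsProd] using this
  | insert m Z hm ih =>
    have hmy : m < y := hZy m (Finset.mem_insert_self _ _)
    obtain ⟨T, hT, hs⟩ := ih m hm fun x hx h => by
      rcases Finset.mem_insert.1 (hZ x (hx.trans hmy) h) with rfl | h'
      · exact absurd hx (lt_irrefl _)
      · exact h'
    have hmT : m ∉ T := fun h => (hm m (hT h)).false
    have hs' := sign_of_ne_zero hψ (s := Set.Ioo m y) Set.ordConnected_Ioo
      fun x hx h => by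
        rcases Finset.mem_insert.1 (hZ x hx.2 h) with rfl | h'
        · exact hx.1.false
        · exact (hx.1.trans (hm x h')).false
    have hpos : ∀ x, m < x → 0 < (rootsProd T).eval x := fun x hx =>
      rootsProd_pos_of_lt fun t ht => (hm t (hT ht)).trans hx
    have hins : ∀ x, (rootsProd (insert m T)).eval x = (x - m) * (rootsProd T).eval x :=
      fun x => by simp only [rootsProd_eval, Finset.prod_insert hmT]
    have hm0 : ∀ {P : ℝ → Prop}, (∀ x < m, P x) → P m → (∀ x ∈ Set.Ioo m y, P x) →
        ∀ x < y, P x := fun h1 h2 h3 x hx => by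
      rcases lt_trichotomy x m with h | rfl | h
      exacts [h1 x h, h2, h3 x ⟨h, hx⟩]
    have hcont : Continuous fun x => (rootsProd T).eval x * ψ x :=
      (rootsProd T).continuous.mul hψ
    have hcl : m ∈ closure (Set.Iio m) := by simp
    -- The largest zero `m` joins `T` exactly when the signs left and right of `m` disagree.
    -- Otherwise the sign at `m` itself follows by continuity.
    rcases hs with hs | hs <;> rcases hs' with hs' | hs'
    · refine ⟨T, hT.trans (Finset.subset_insert _ _), Or.inl (hm0 hs ?_ fun x hx =>
        mul_nonneg (hpos x hx.1).le (hs' x hx))⟩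
      exact le_on_closure (f := fun _ => (0 : ℝ)) (fun x hx => hs x hx) continuousOn_const
        hcont.continuousOn hcl
    · refine ⟨insert m T, Finset.insert_subset_insert _ hT, Or.inr (hm0 (fun x hx => ?_) ?_
        fun x hx => ?_)⟩
      · rw [hins, mul_assoc]
        exact mul_nonpos_of_nonpos_of_nonneg (by linarith) (hs x hx)
      · rw [hins]; simp
      · rw [hins, mul_assoc]
        exact mul_nonpos_of_nonneg_of_nonpos (by linarith [hx.1])
          (mul_nonpos_of_nonneg_of_nonpos (hpos x hx.1).le (hs' x hx))
    · refine ⟨insert m T, Finset.insert_subset_insert _ hT, Or.inl (hm0 (fun x hx => ?_) ?_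
        fun x hx => ?_)⟩
      · rw [hins, mul_assoc]
        exact mul_nonneg_of_nonpos_of_nonpos (by linarith) (hs x hx)
      · rw [hins]; simp
      · rw [hins, mul_assoc]
        exact mul_nonneg (by linarith [hx.1]) (mul_nonneg (hpos x hx.1).le (hs' x hx))
    · refine ⟨T, hT.trans (Finset.subset_insert _ _), Or.inr (hm0 hs ?_ fun x hx =>
        mul_nonpos_of_nonneg_of_nonpos (hpos x hx.1).le (hs' x hx))⟩
      exact le_on_closure (g := fun _ => (0 : ℝ)) (fun x hx => hs x hx) hcont.continuousOn
        continuousOn_const hcl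

/-- Rolle: between two points of `Z` the derivative `e^{-x²/2} f` vanishes, hence `f` has a root
there. -/
theorem card_zeros_primitive_le {f : ℝ[X]} (hf : f ≠ 0) (a : ℝ) (Z : Finset ℝ)
    (hZ : ∀ z ∈ Z, primitive f z = a) : Z.card ≤ f.natDegree + 1 := by
  have h : Z.card ≤ f.roots.toFinset.card + 1 := by
    refine Finset.card_le_of_interleaved fun u hu v hv huv _ => ?_
    obtain ⟨c, hc, hc0⟩ := exists_hasDerivAt_eq_zero huv (continuous_primitive f).continuousOn
      ((hZ u hu).trans (hZ v hv).symm) fun x _ => hasDerivAt_primitive f x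
    refine ⟨c, ?_, hc.1, hc.2⟩
    rw [Multiset.mem_toFinset, mem_roots hf]
    exact (mul_eq_zero.1 hc0).resolve_left (Real.exp_pos _).ne'
  exact h.trans (Nat.add_le_add_right ((Multiset.toFinset_card_le _).trans (card_roots' f)) 1)

theorem finite_zeros_primitive {f : ℝ[X]} (hf : f ≠ 0) (a : ℝ) :
    {x | primitive f x = a}.Finite := by
  by_contra hinf
  obtain ⟨Z, hZ, hcard⟩ := Set.Infinite.exists_subset_card_eq hinf (f.natDegree + 2)
  have := card_zeros_primitive_le hf a Z fun z hz => hZ hz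
  omega

/-- The skew-inner product is nondegenerate on the polynomials of degree less than `2 n`. -/
theorem eq_zero_of_skew1_eq_zero {y : ℝ} {n : ℕ} {f : ℝ[X]} (hfd : f.degree < (2 * n : ℕ))
    (hf : ∀ g : ℝ[X], g.degree < (2 * n : ℕ) → skew1 y g f = 0) : f = 0 := by
  by_contra hne
  have hfn : f.natDegree < 2 * n := (natDegree_lt_iff_degree_lt hne).2 hfd
  set ψ : ℝ → ℝ := fun x => primitive f y - 2 * primitive f x with hψdef
  have hψ : Continuous ψ := continuous_const.sub ((continuous_primitive f).const_mul 2)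
  have hψ0 : ∀ x, ψ x = 0 ↔ primitive f x = primitive f y / 2 := fun x => by
    simp only [hψdef]
    constructor <;> intro h <;> linarith
  have hfin := finite_zeros_primitive hne (primitive f y / 2)
  set Z : Finset ℝ := hfin.toFinset.filter (· < y) with hZdef
  have hZ : ∀ x, x ∈ Z ↔ ψ x = 0 ∧ x < y := fun x => by simp [hZdef, hψ0]
  obtain ⟨T, hTZ, hs⟩ := exists_rootsProd_sign hψ Z y (fun z hz => ((hZ z).1 hz).2)
    fun x hx h => (hZ x).2 ⟨h, hx⟩
  have hZcard : Z.card ≤ f.natDegree + 1 := card_zeros_primitive_le hne (primitive f y / 2) Z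
    fun z hz => (hψ0 z).1 ((hZ z).1 hz).1
  -- Otherwise `rootsProd T` is an admissible test function, and an integrand of constant sign with
  -- zero integral would vanish almost everywhere, although its zeros below `y` lie in the finite
  -- set `Z`.
  have hTcard : 2 * n ≤ T.card := by
    by_contra! hlt
    have h0 := hf (rootsProd T) (by
      rw [degree_eq_natDegree (rootsProd_monic T).ne_zero, rootsProd_natDegree]
      exact_mod_cast hlt)
    rw [skew1_eq, integral_Iic_eq_integral_Iio] at h0
    have h0' : ∫ x in Set.Iio y, Real.exp (-x ^ 2 / 2) * (rootsProd T).eval x * ψ x = 0 := by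
      simpa using h0
    have hint := (integrable_skew1 y (rootsProd T) f).integrableOn (s := Set.Iio y)
    have hae : ∀ᵐ x ∂(volume.restrict (Set.Iio y)),
        Real.exp (-x ^ 2 / 2) * (rootsProd T).eval x * ψ x = 0 := by
      rcases hs with hs | hs
      · refine (setIntegral_eq_zero_iff_of_nonneg_ae ?_ hint).1 h0'
        refine (ae_restrict_iff' measurableSet_Iio).2 (ae_of_all _ fun x hx => ?_)
        simp only [Pi.zero_apply, mul_assoc]
        exact mul_nonneg (Real.exp_pos _).le (hs x hx)
      · have h1 : ∫ x in Set.Iio y, -(Real.exp (-x ^ 2 / 2) * (rootsProd T).eval x * ψ x) = 0 := by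
          rw [integral_neg, h0', neg_zero]
        have := (setIntegral_eq_zero_iff_of_nonneg_ae ?_ hint.neg).1 h1
        · filter_upwards [this] with x hx
          simpa using hx
        refine (ae_restrict_iff' measurableSet_Iio).2 (ae_of_all _ fun x hx => ?_)
        simp only [Pi.zero_apply, Pi.neg_apply, mul_assoc]
        have := mul_nonpos_of_nonneg_of_nonpos (Real.exp_pos (-x ^ 2 / 2)).le (hs x hx)
        simpa [hψdef] using this
    have hnull : ∀ᵐ x : ℝ, x ∉ (Z : Set ℝ) := by
      rw [ae_iff]
      simpa using Z.finite_toSet.measure_zero volume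
    have hfalse : ∀ᵐ x ∂(volume.restrict (Set.Iio y)), False := by
      filter_upwards [hae, ae_restrict_of_ae hnull, ae_restrict_mem measurableSet_Iio]
        with x hx hxZ hxy
      rcases mul_eq_zero.1 hx with h | h
      · rcases mul_eq_zero.1 h with h | h
        · exact (Real.exp_pos _).ne' h
        · rw [rootsProd_eval, Finset.prod_eq_zero_iff] at h
          obtain ⟨t, ht, hxt⟩ := h
          rw [sub_eq_zero.1 hxt] at hxZ
          exact hxZ (hTZ ht)
      · exact hxZ ((hZ x).2 ⟨h, hxy⟩)
    rw [ae_iff] at hfalse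
    simp at hfalse
  have hTeq : T = Z := Finset.eq_of_subset_of_card_le hTZ (by omega)
  have hcard : T.card = 2 * n := by
    have := Finset.card_le_card hTZ
    omega
  have hψy : ψ y = - primitive f y := by simp only [hψdef]; ring
  have hposy : 0 < (rootsProd T).eval y :=
    rootsProd_pos_of_lt fun t ht => ((hZ t).1 (hTZ ht)).2
  have hψbot : Tendsto ψ atBot (𝓝 (primitive f y)) := by
    simpa using ((tendsto_primitive_atBot f).const_mul 2).const_sub (primitive f y)
  have hposbot : ∀ᶠ x in atBot, x < y ∧ 0 < (rootsProd T).eval x := by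
    have h1 : ∀ᶠ x in atBot, ∀ t ∈ T, x < t :=
      (Finset.eventually_all T).2 fun t _ => eventually_lt_atBot t
    filter_upwards [h1, eventually_lt_atBot y] with x hx hxy
    exact ⟨hxy, rootsProd_pos_of_gt (hcard ▸ even_two_mul n) hx⟩
  have hcont : Continuous fun x => (rootsProd T).eval x * ψ x :=
    (rootsProd T).continuous.mul hψ
  have hcl : y ∈ closure (Set.Iio y) := by simp
  -- `rootsProd T` is positive at `y` and, having even degree, also near `-∞`. There `ψ` takes the
  -- value `-F(y)` and has the limit `F(y)`, which must not have opposite signs.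
  have hA : primitive f y = 0 := by
    rcases hs with hs | hs
    · have h1 : 0 ≤ primitive f y := ge_of_tendsto hψbot (hposbot.mono fun x hx =>
        nonneg_of_mul_nonneg_right (hs x hx.1) hx.2)
      have h2 : 0 ≤ (rootsProd T).eval y * ψ y :=
        le_on_closure (f := fun _ => (0 : ℝ)) (fun x hx => hs x hx) continuousOn_const
          hcont.continuousOn hcl
      have h3 := nonneg_of_mul_nonneg_right h2 hposy
      linarith
    · have h1 : primitive f y ≤ 0 := le_of_tendsto hψbot (hposbot.mono fun x hx =>
        nonpos_of_mul_nonpos_right (hs x hx.1) hx.2)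
      have h2 : (rootsProd T).eval y * ψ y ≤ 0 :=
        le_on_closure (g := fun _ => (0 : ℝ)) (fun x hx => hs x hx) hcont.continuousOn
          continuousOn_const hcl
      have h3 := nonpos_of_mul_nonpos_right h2 hposy
      linarith
  have hyZ : y ∉ Z := fun h => ((hZ y).1 h).2.false
  -- With `F(y) = 0` the endpoint `y` is a zero too, giving `2n + 1` zeros against the Rolle bound
  -- `2n`.
  have := card_zeros_primitive_le hne (primitive f y / 2) (insert y Z) fun z hz => by
    rcases Finset.mem_insert.1 hz with rfl | hz
    · rw [hA, zero_div]
    · exact (hψ0 z).1 ((hZ z).1 hz).1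
  rw [Finset.card_insert_of_notMem hyZ, ← hTeq, hcard] at this
  omega

/-! ### Skew-orthogonality as a linear system, and its solution by Pfaffians. -/

theorem skew1_sum_left {ι : Type*} (y : ℝ) (s : Finset ι) (c : ι → ℝ) (f : ι → ℝ[X]) (g : ℝ[X]) :
    skew1 y (∑ k ∈ s, c k • f k) g = ∑ k ∈ s, c k * skew1 y (f k) g := by
  simp only [← skewForm_apply, map_sum, map_smul, LinearMap.sum_apply, LinearMap.smul_apply,
    smul_eq_mul]

theorem skew1_sum_right {ι : Type*} (y : ℝ) (s : Finset ι) (c : ι → ℝ) (f : ι → ℝ[X]) (g : ℝ[X]) :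
    skew1 y g (∑ k ∈ s, c k • f k) = ∑ k ∈ s, c k * skew1 y g (f k) := by
  simp only [← skewForm_apply, map_sum, map_smul, smul_eq_mul]

theorem skew1_eq_zero_of_degree_lt {y : ℝ} {p : ℕ → ℝ[X]} (hm : ∀ j, (p j).Monic)
    (hd : ∀ j, (p j).natDegree = j) {f : ℝ[X]} {n : ℕ} (h : ∀ l < n, skew1 y f (p l) = 0)
    {g : ℝ[X]} (hg : g.degree < n) : skew1 y f g = 0 :=
  mem_of_degree_lt hm hd (W := (skewForm y f).ker) h hg

theorem degree_sum_lt {p : ℕ → ℝ[X]} (hd : ∀ j, (p j).natDegree = j) (c : ℕ → ℝ) (j : ℕ) :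
    (∑ k ∈ Finset.range j, c k • p k).degree < j := by
  rw [← mem_degreeLT]
  refine Submodule.sum_mem _ fun k hk => Submodule.smul_mem _ _ (mem_degreeLT.2 ?_)
  refine degree_le_natDegree.trans_lt ?_
  rw [hd]
  exact_mod_cast Finset.mem_range.1 hk

theorem coeff_sum_range_succ {p : ℕ → ℝ[X]} (hm : ∀ j, (p j).Monic)
    (hd : ∀ j, (p j).natDegree = j) (c : ℕ → ℝ) (j : ℕ) :
    (∑ k ∈ Finset.range (j + 1), c k • p k).coeff j = c j := by
  have h1 : (p j).coeff j = 1 := by simpa [Monic, leadingCoeff, hd] using hm j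
  rw [Finset.sum_range_succ, coeff_add, coeff_eq_zero_of_degree_lt (degree_sum_lt hd c j)]
  simp [h1]

theorem monic_and_natDegree_sum {p : ℕ → ℝ[X]} (hm : ∀ j, (p j).Monic)
    (hd : ∀ j, (p j).natDegree = j) (c : ℕ → ℝ) (j : ℕ) (hc : c j = 1) :
    (∑ k ∈ Finset.range (j + 1), c k • p k).Monic ∧
      (∑ k ∈ Finset.range (j + 1), c k • p k).natDegree = j := by
  have hco := coeff_sum_range_succ hm hd c j
  rw [hc] at hco
  have hle : (∑ k ∈ Finset.range (j + 1), c k • p k).natDegree ≤ j := by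
    have := degree_sum_lt hd c (j + 1)
    rw [natDegree_le_iff_coeff_eq_zero]
    exact fun m hm => coeff_eq_zero_of_degree_lt (this.trans_le (by exact_mod_cast hm))
  exact ⟨monic_of_natDegree_le_of_coeff_eq_one j hle hco,
    le_antisymm hle (le_natDegree_of_ne_zero (by rw [hco]; exact one_ne_zero))⟩

/-- Both members of the `i`-th pair need only be tested on degrees `< 2i`: within a pair,
skew-symmetry leaves the single free number `r i`. -/
theorem isSkewOrthogonal_of_forall_degree_lt {y : ℝ} {R : ℕ → ℝ[X]} (hm : ∀ j, (R j).Monic)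
    (hd : ∀ j, (R j).natDegree = j)
    (h0 : ∀ i (g : ℝ[X]), g.degree < (2 * i : ℕ) → skew1 y (R (2 * i)) g = 0)
    (h1 : ∀ i (g : ℝ[X]), g.degree < (2 * i : ℕ) → skew1 y (R (2 * i + 1)) g = 0) :
    IsSkewOrthogonal y R fun i => skew1 y (R (2 * i)) (R (2 * i + 1)) := by
  have hdeg : ∀ a i, a < 2 * i → (R a).degree < (2 * i : ℕ) := fun a i hai =>
    degree_le_natDegree.trans_lt (by rw [hd]; exact_mod_cast hai)
  have heo : ∀ j k, skew1 y (R (2 * j)) (R (2 * k + 1)) =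
      if j = k then skew1 y (R (2 * j)) (R (2 * j + 1)) else 0 := fun j k => by
    rcases lt_trichotomy j k with h | rfl | h
    · rw [skew1_swap, h1 k _ (hdeg _ _ (by omega)), if_neg h.ne, neg_zero]
    · rw [if_pos rfl]
    · rw [h0 j _ (hdeg _ _ (by omega)), if_neg h.ne']
  refine ⟨hm, hd, fun j k => ?_, fun j k => ?_, heo, fun j k => ?_⟩
  · rcases lt_trichotomy j k with h | rfl | h
    · rw [skew1_swap, h0 k _ (hdeg _ _ (by omega)), neg_zero]
    · exact skew1_self _ _
    · exact h0 j _ (hdeg _ _ (by omega))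
  · rcases lt_trichotomy j k with h | rfl | h
    · rw [skew1_swap, h1 k _ (hdeg _ _ (by omega)), neg_zero]
    · exact skew1_self _ _
    · exact h1 j _ (hdeg _ _ (by omega))
  · rw [skew1_swap, heo]

theorem IsSkewOrthogonal.skew1_eq_zero {y : ℝ} {R : ℕ → ℝ[X]} {r : ℕ → ℝ}
    (hR : IsSkewOrthogonal y R r) {i b : ℕ} (hb : b < 2) {g : ℝ[X]}
    (hg : g.degree < (2 * i : ℕ)) : skew1 y (R (2 * i + b)) g = 0 := by
  refine skew1_eq_zero_of_degree_lt hR.monic hR.natDegree (fun l hl => ?_) hg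
  have hl' : i ≠ l / 2 := by omega
  rcases Nat.mod_two_eq_zero_or_one l with h | h
  · rw [show l = 2 * (l / 2) by omega]
    interval_cases b
    · exact hR.even_even _ _
    · rw [hR.odd_even, if_neg hl'.symm, neg_zero]
  · rw [show l = 2 * (l / 2) + 1 by omega]
    interval_cases b
    · exact (hR.even_odd _ _).trans (if_neg hl')
    · exact hR.odd_odd _ _

theorem IsSkewOrthogonal.skewBlock_apply {y : ℝ} {R : ℕ → ℝ[X]} {r : ℕ → ℝ}
    (hR : IsSkewOrthogonal y R r) {n : ℕ} (a b : Fin (2 * n)) :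
    skewBlock r n a b = skew1 y (R a) (R b) := by
  have ha : (a : ℕ) = 2 * (a / 2) ∨ (a : ℕ) = 2 * (a / 2) + 1 := by omega
  have hb : (b : ℕ) = 2 * (b / 2) ∨ (b : ℕ) = 2 * (b / 2) + 1 := by omega
  simp only [skewBlock, Matrix.of_apply]
  generalize (a : ℕ) / 2 = i at *
  generalize (b : ℕ) / 2 = j at *
  generalize (a : ℕ) = a at *
  generalize (b : ℕ) = b at *
  rcases ha with rfl | rfl <;> rcases hb with rfl | rfl
  · rw [hR.even_even]
    split_ifs <;> first | rfl | omega
  · rw [hR.even_odd]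
    split_ifs <;> first | rfl | omega
  · rw [hR.odd_even]
    split_ifs <;> first | (subst i; rfl) | exact neg_zero.symm | exact neg_zero | omega
  · rw [hR.odd_odd]
    split_ifs <;> first | rfl | omega

theorem IsOrthogonal.V_apply {y : ℝ} {p : ℕ → ℝ[X]} (hp : IsOrthogonal y p) (m : ℕ)
    (a b : Fin m) : V y p m a b = skew1 y (p a) (p b) :=
  hp.v_eq_skew1 a b

/-- The coefficients form a lower unitriangular `L` of determinant `1`, and `L V Lᵀ` is the block
diagonal Gram matrix of `R`. -/
theorem IsOrthogonal.pf_V_eq_prod {y : ℝ} {p R : ℕ → ℝ[X]} (hp : IsOrthogonal y p) {r : ℕ → ℝ}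
    {α : ℕ → ℕ → ℝ} (hRα : ∀ j, R j = ∑ k ∈ Finset.range (j + 1), α j k • p k)
    (hα : ∀ j, α j j = 1) (hR : IsSkewOrthogonal y R r) (n : ℕ) :
    pf (V y p (2 * n)) = ∏ i : Fin n, r i := by
  let L : Matrix (Fin (2 * n)) (Fin (2 * n)) ℝ := Matrix.of fun a b => if b ≤ a then α a b else 0
  have hdet : L.det = 1 := by
    rw [Matrix.det_of_isLowerTriangular L fun a b hab => if_neg (not_le.2 hab)]
    exact Finset.prod_eq_one fun a _ => (if_pos le_rfl).trans (hα a)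
  have hRL : ∀ a : Fin (2 * n), R a = ∑ k, L a k • p k := fun a => by
    have h1 : ∀ k : Fin (2 * n), L a k • p k =
        (fun k : ℕ => (if k ≤ a then α a k else 0) • p k) k := fun k => rfl
    rw [hRα, Finset.sum_congr rfl fun k _ => h1 k,
      Fin.sum_univ_eq_sum_range (fun k : ℕ => (if k ≤ (a : ℕ) then α a k else 0) • p k)]
    have hsub : Finset.range ((a : ℕ) + 1) ⊆ Finset.range (2 * n) :=
      Finset.range_subset_range.2 a.2
    rw [← Finset.sum_subset hsub fun k _ hk => ?_]
    · refine Finset.sum_congr rfl fun k hk => ?_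
      rw [if_pos (Nat.lt_succ_iff.1 (Finset.mem_range.1 hk))]
    · rw [if_neg, zero_smul]
      rw [Finset.mem_range] at hk
      omega
  have hLV : L * V y p (2 * n) * L.transpose = skewBlock r n := by
    ext a b
    rw [hR.skewBlock_apply, hRL a, hRL b, skew1_sum_right, Matrix.mul_apply]
    refine Finset.sum_congr rfl fun l _ => ?_
    rw [skew1_sum_left, Matrix.mul_apply, Matrix.transpose_apply, mul_comm]
    simp only [hp.V_apply]
  rw [← pf_skewBlock, ← hLV, pf_congruence, hdet, one_mul]

theorem IsOrthogonal.V_transpose {y : ℝ} {p : ℕ → ℝ[X]} (hp : IsOrthogonal y p) (m : ℕ) :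
    (V y p m).transpose = - V y p m := by
  ext a b
  rw [Matrix.transpose_apply, Matrix.neg_apply, hp.V_apply, hp.V_apply, skew1_swap]

theorem IsOrthogonal.linearIndependent {y : ℝ} {p : ℕ → ℝ[X]} (hp : IsOrthogonal y p) :
    LinearIndependent ℝ p :=
  Polynomial.Sequence.linearIndependent
    ⟨p, fun j => by rw [degree_eq_natDegree (hp.monic j).ne_zero, hp.natDegree]⟩

theorem IsOrthogonal.eq_zero_of_skew1_left {y : ℝ} {p : ℕ → ℝ[X]} (hp : IsOrthogonal y p) {n : ℕ}
    {f : ℝ[X]} (hfd : f.degree < (2 * n : ℕ)) (hf : ∀ l < 2 * n, skew1 y f (p l) = 0) :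
    f = 0 :=
  eq_zero_of_skew1_eq_zero hfd fun g hg => by
    rw [skew1_swap, skew1_eq_zero_of_degree_lt hp.monic hp.natDegree hf hg, neg_zero]

/-- Nondegeneracy makes the Gram matrix invertible, so the system is solvable for every right-hand
side. -/
theorem IsOrthogonal.exists_coeff {y : ℝ} {p : ℕ → ℝ[X]} (hp : IsOrthogonal y p) (n : ℕ)
    (u : Fin (2 * n) → ℝ) : ∃ c : ℕ → ℝ, ∀ l : Fin (2 * n),
      u l + ∑ k : Fin (2 * n), c k * V y p (2 * n) k l = 0 := by
  have hinj : Function.Injective (V y p (2 * n)).vecMul := by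
    rw [← Matrix.coe_vecMulLinear, injective_iff_map_eq_zero]
    intro c hc
    have hl : ∀ l, ∑ k, c k * V y p (2 * n) k l = 0 := fun l => congrFun hc l
    have hf : ∑ k, c k • p k = 0 := by
      refine hp.eq_zero_of_skew1_left (n := n) ?_ fun l hlt => ?_
      · rw [← mem_degreeLT]
        refine Submodule.sum_mem _ fun k _ => Submodule.smul_mem _ _ (mem_degreeLT.2 ?_)
        refine degree_le_natDegree.trans_lt ?_
        rw [hp.natDegree]
        exact_mod_cast k.2
      · rw [skew1_sum_left, ← hl ⟨l, hlt⟩]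
        simp only [hp.V_apply]
    exact funext (Fintype.linearIndependent_iff.1
      (hp.linearIndependent.comp _ Fin.val_injective) c hf)
  have hsurj := Matrix.vecMul_surjective_iff_isUnit.2 (Matrix.vecMul_injective_iff_isUnit.1 hinj)
  obtain ⟨c, hc⟩ := hsurj (-u)
  refine ⟨fun k => if hk : k < 2 * n then c ⟨k, hk⟩ else 0, fun l => ?_⟩
  have : ∑ k, c k * V y p (2 * n) k l = - u l := congrFun hc l
  simp [this]

theorem IsOrthogonal.skew1_eq_zero_iff {y : ℝ} {p : ℕ → ℝ[X]} (hp : IsOrthogonal y p)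
    (n η : ℕ) (c : ℕ → ℝ) :
    (∀ g : ℝ[X], g.degree < (2 * n : ℕ) →
      skew1 y (p η + ∑ k ∈ Finset.range (2 * n), c k • p k) g = 0) ↔
    ∀ l : Fin (2 * n), v y p η l + ∑ k : Fin (2 * n), c k * V y p (2 * n) k l = 0 := by
  have key : ∀ l : Fin (2 * n), skew1 y (p η + ∑ k ∈ Finset.range (2 * n), c k • p k) (p l) =
      v y p η l + ∑ k : Fin (2 * n), c k * V y p (2 * n) k l := fun l => by
    simp only [hp.V_apply]
    rw [skew1_add_left, skew1_sum_left, hp.v_eq_skew1,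
      Fin.sum_univ_eq_sum_range (fun k => c k * skew1 y (p k) (p l))]
  constructor
  · intro h l
    rw [← key]
    refine h _ (degree_le_natDegree.trans_lt ?_)
    rw [hp.natDegree]
    exact_mod_cast l.2
  · intro h g hg
    refine skew1_eq_zero_of_degree_lt hp.monic hp.natDegree (fun l hl => ?_) hg
    exact (key ⟨l, hl⟩).trans (h ⟨l, hl⟩)

theorem IsOrthogonal.Vsubst_eq_replaceIndex {y : ℝ} {p : ℕ → ℝ[X]} (hp : IsOrthogonal y p)
    (m η : ℕ) (k : Fin m) :
    Vsubst y p m k η = replaceIndex (V y p m) k fun l => v y p η l := by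
  ext a b
  simp only [Vsubst, replaceIndex, Matrix.of_apply, Fin.ext_iff, V, hp.v_eq_skew1]
  split_ifs
  · exact skew1_self _ _
  · rfl
  · exact skew1_swap _ _ _
  · rfl

/-- A skew-orthogonal family is constructed without Pfaffians from `exists_coeff`; then the Pfaffian
is the product of its normalizations, none of which vanishes. -/
theorem IsOrthogonal.pf_V_ne_zero {y : ℝ} {p : ℕ → ℝ[X]} (hp : IsOrthogonal y p) (n : ℕ) :
    pf (V y p (2 * n)) ≠ 0 := by
  choose c hc using fun j : ℕ => hp.exists_coeff (j / 2) fun l => v y p j l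
  have hc' : ∀ (j : ℕ) (g : ℝ[X]), g.degree < (2 * (j / 2) : ℕ) →
      skew1 y (p j + ∑ k ∈ Finset.range (2 * (j / 2)), c j k • p k) g = 0 := fun j =>
    (hp.skew1_eq_zero_iff (j / 2) j (c j)).2 (hc j)
  -- The value `0` is met only at `k = j - 1` for odd `j` and beyond `j`.
  let α : ℕ → ℕ → ℝ := fun j k => if k = j then 1 else if k < 2 * (j / 2) then c j k else 0
  let R : ℕ → ℝ[X] := fun j => ∑ k ∈ Finset.range (j + 1), α j k • p k
  have hα : ∀ j, α j j = 1 := fun j => if_pos rfl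
  have hR : ∀ j, R j = p j + ∑ k ∈ Finset.range (2 * (j / 2)), c j k • p k := fun j => by
    have hsub : Finset.range (2 * (j / 2)) ⊆ Finset.range j :=
      Finset.range_subset_range.2 (by omega)
    change ∑ k ∈ Finset.range (j + 1), α j k • p k = _
    rw [Finset.sum_range_succ, hα, one_smul, add_comm, ← Finset.sum_subset hsub fun k hk hk' => ?_]
    · congr 1
      refine Finset.sum_congr rfl fun k hk => ?_
      have := Finset.mem_range.1 hk
      have h2 : k ≠ j := by omega
      simp only [α, if_neg h2, if_pos this]
    · have h1 : ¬ k < 2 * (j / 2) := fun h => hk' (Finset.mem_range.2 h)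
      have h2 : k ≠ j := (Finset.mem_range.1 hk).ne
      simp only [α, if_neg h2, if_neg h1, zero_smul]
  have hmd : ∀ j, (R j).Monic ∧ (R j).natDegree = j := fun j =>
    monic_and_natDegree_sum hp.monic hp.natDegree (α j) j (hα j)
  have hS := isSkewOrthogonal_of_forall_degree_lt (y := y) (fun j => (hmd j).1)
    (fun j => (hmd j).2)
    (fun i g hg => by
      have := hc' (2 * i) g (by rwa [show 2 * i / 2 = i by omega])
      rwa [← hR] at this)
    (fun i g hg => by
      have := hc' (2 * i + 1) g (by rwa [show (2 * i + 1) / 2 = i by omega])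
      rwa [← hR] at this)
  rw [hp.pf_V_eq_prod (fun j => rfl) hα hS n, Finset.prod_ne_zero_iff]
  -- If `r i = 0`, then `R (2 * i)` is skew-orthogonal to `R 0, …, R (2 * i + 1)`, hence zero by
  -- nondegeneracy in degrees `< 2 (i + 1)`.
  intro i _ h0
  refine (hmd (2 * i)).1.ne_zero (eq_zero_of_skew1_eq_zero (y := y) (n := i + 1) ?_ fun g hg => ?_)
  · refine degree_le_natDegree.trans_lt ?_
    rw [(hmd _).2]
    exact_mod_cast (by omega : 2 * (i : ℕ) < 2 * (i + 1))
  · rw [skew1_swap, neg_eq_zero]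
    refine skew1_eq_zero_of_degree_lt (fun j => (hmd j).1) (fun j => (hmd j).2)
      (fun l hl => ?_) hg
    rcases (by omega : l < 2 * (i : ℕ) ∨ l = 2 * i ∨ l = 2 * i + 1) with h | rfl | rfl
    · refine hS.skew1_eq_zero (b := 0) two_pos (degree_le_natDegree.trans_lt ?_)
      rw [(hmd _).2]
      exact_mod_cast h
    · exact skew1_self _ _
    · exact h0

theorem IsOrthogonal.skew1_eq_zero_iff_pf {y : ℝ} {p : ℕ → ℝ[X]} (hp : IsOrthogonal y p)
    (n η : ℕ) (c : ℕ → ℝ) :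
    (∀ g : ℝ[X], g.degree < (2 * n : ℕ) →
      skew1 y (p η + ∑ k ∈ Finset.range (2 * n), c k • p k) g = 0) ↔
    ∀ k < 2 * n, c k = - (pf (Vsubst y p (2 * n) k η) / pf (V y p (2 * n))) := by
  have hne := hp.pf_V_ne_zero n
  have key : ∀ c : ℕ → ℝ,
      (∀ l : Fin (2 * n), v y p η l + ∑ k : Fin (2 * n), c k * V y p (2 * n) k l = 0) →
      ∀ k < 2 * n, c k = - (pf (Vsubst y p (2 * n) k η) / pf (V y p (2 * n))) := by
    intro c hc k hk
    have h := pf_replaceIndex (V y p (2 * n)) (hp.V_transpose _) (fun l => v y p η l)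
      (fun k => c k) hc ⟨k, hk⟩
    rw [← hp.Vsubst_eq_replaceIndex] at h
    rw [h]
    field_simp
  rw [hp.skew1_eq_zero_iff]
  refine ⟨key c, fun h => ?_⟩
  -- Some solution exists, and by the Cramer rule its entries are the same Pfaffian quotients as
  -- those of `c`.
  obtain ⟨c', hc'⟩ := hp.exists_coeff n fun l => v y p η l
  have heq : ∀ k : Fin (2 * n), c k = c' k := fun k => by rw [h k k.2, key c' hc' k k.2]
  simpa only [heq] using hc'

end GOE

theorem propositionp (y : ℝ) (p : ℕ → ℝ[X]) (hp : GOE.IsOrthogonal y p) :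
    -- the explicit matrices are the Gram matrices of the skew-inner product
    (∀ m : ℕ, GOE.V y p m =
      Matrix.of fun j k : Fin m => GOE.skew1 y (p (j : ℕ)) (p (k : ℕ))) ∧
    -- the denominators do not vanish
    (∀ i : ℕ, GOE.pf (GOE.V y p (2 * i)) ≠ 0) ∧
    -- the coefficients and the normalizations
    (∀ (R : ℕ → ℝ[X]) (r : ℕ → ℝ) (α : ℕ → ℕ → ℝ),
      (∀ j, R j = ∑ k ∈ Finset.range (j + 1), α j k • p k) →
      (∀ i, α (2 * i + 1) (2 * i) = 0) →
      (GOE.IsSkewOrthogonal y R r ↔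
        (∀ j, α j j = 1) ∧
        (∀ i ≥ 1, ∀ k < 2 * i, α (2 * i) k =
          - (GOE.pf (GOE.Vsubst y p (2 * i) k (2 * i)) / GOE.pf (GOE.V y p (2 * i)))) ∧
        (∀ i ≥ 1, ∀ k < 2 * i, α (2 * i + 1) k =
          - (GOE.pf (GOE.Vsubst y p (2 * i) k (2 * i + 1)) / GOE.pf (GOE.V y p (2 * i)))) ∧
        (∀ j, r j = GOE.pf (GOE.V y p (2 * (j + 1))) / GOE.pf (GOE.V y p (2 * j))))) := by
  refine ⟨fun m => by ext a b; exact hp.V_apply m a b, hp.pf_V_ne_zero,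
    fun R r α hRα hodd => ?_⟩
  have heven' : ∀ i, α (2 * i) (2 * i) = 1 →
      R (2 * i) = p (2 * i) + ∑ k ∈ Finset.range (2 * i), α (2 * i) k • p k := fun i h => by
    rw [hRα, Finset.sum_range_succ, h, one_smul, add_comm]
  have hodd' : ∀ i, α (2 * i + 1) (2 * i + 1) = 1 → R (2 * i + 1) =
      p (2 * i + 1) + ∑ k ∈ Finset.range (2 * i), α (2 * i + 1) k • p k := fun i h => by
    rw [hRα, Finset.sum_range_succ, Finset.sum_range_succ, hodd, h, one_smul, zero_smul, add_zero,
      add_comm]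
  -- Consecutive Pfaffians are products of normalizations differing by the one factor `r' j`. An
  -- arbitrary `r'` is allowed since the converse direction applies this before knowing that `r` is
  -- the normalization.
  have hratio : ∀ r' : ℕ → ℝ, (∀ j, α j j = 1) → GOE.IsSkewOrthogonal y R r' → ∀ j,
      r' j = GOE.pf (GOE.V y p (2 * (j + 1))) / GOE.pf (GOE.V y p (2 * j)) := by
    intro r' hα hR j
    rw [eq_div_iff (hp.pf_V_ne_zero j), hp.pf_V_eq_prod hRα hα hR, hp.pf_V_eq_prod hRα hα hR,
      Fin.prod_univ_castSucc, mul_comm]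
    rfl
  constructor
  · intro hR
    have hα : ∀ j, α j j = 1 := fun j => by
      rw [← GOE.coeff_sum_range_succ hp.monic hp.natDegree (α j) j, ← hRα]
      simpa [Monic, leadingCoeff, hR.natDegree] using hR.monic j
    refine ⟨hα, fun i _ => ?_, fun i _ => ?_, hratio r hα hR⟩
    · refine (hp.skew1_eq_zero_iff_pf i (2 * i) (α (2 * i))).1 fun g hg => ?_
      rw [← heven' i (hα _)]
      exact hR.skew1_eq_zero (b := 0) two_pos hg
    · refine (hp.skew1_eq_zero_iff_pf i (2 * i + 1) (α (2 * i + 1))).1 fun g hg => ?_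
      rw [← hodd' i (hα _)]
      exact hR.skew1_eq_zero one_lt_two hg
  · rintro ⟨hα, h0, h1, hr⟩
    have hmd : ∀ j, (R j).Monic ∧ (R j).natDegree = j := fun j => by
      rw [hRα]
      exact GOE.monic_and_natDegree_sum hp.monic hp.natDegree (α j) j (hα j)
    have hS := GOE.isSkewOrthogonal_of_forall_degree_lt (y := y) (fun j => (hmd j).1)
      (fun j => (hmd j).2)
      (fun i => by
        rw [heven' i (hα _)]
        exact (hp.skew1_eq_zero_iff_pf i _ _).2 fun k hk => h0 i (by omega) k hk)
      (fun i => by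
        rw [hodd' i (hα _)]
        exact (hp.skew1_eq_zero_iff_pf i _ _).2 fun k hk => h1 i (by omega) k hk)
    -- The actual normalizations satisfy the same quotient formula as `r`.
    have hreq : r = fun i => GOE.skew1 y (R (2 * i)) (R (2 * i + 1)) :=
      funext fun j => (hr j).trans (hratio _ hα hS j).symm
    rwa [hreq]
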